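/- Let $n\ge 2$ and let $D\subset\mathbb C^n$ be a domain (a nonempty connected open set). Suppose that $D$ is $\mathbb C$-convex, i.e. $D\cap l$ is a simply connected domain in $l$ for every complex affine line $l$ meeting $D$, and that $D$ is non-degenerate, i.e. it contains no complex affine line. Let $\mathbb B^n$ be the open Euclidean unit ball of $\mathbb C^n$, write $\det\psi'$ for the complex Jacobian determinant of a holomorphic map $\psi$, let $\mathcal O(X,Y)$ be the set of holomorphic maps from $X$ to $Y$, and for $z\in D$ let \[ c_D(z)=\sup\{|\det\psi'(z)|^2:\psi\in\mathcal O(D,\mathbb B^n),\ \psi(z)=0\}, \qquad k_D(z)=\inf\{|\det\psi'(0)|^{-2}:\psi\in\mathcal O(\mathbb B^n,D),\ \psi(0)=z\} \] (with $0^{-2}=+\infty$) be the Carathéodory and the Kobayashi--Eisenman volume elements. Then for every $z\in D$ one has $k_D(z)>0$, so that the quotient invariant $q_D(z)=c_D(z)/k_D(z)$ is well defined, and \[ q_D(z)\ \ge\ \left(\frac{3}{16\,n\,(4^n-1)}\right)^{n}. \] -/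

import Mathlib

/-- `ℂⁿ` with its standard Hermitian inner product and Euclidean norm. -/
abbrev Cn (n : ℕ) : Type := EuclideanSpace ℂ (Fin n)

/-- A complex affine line in `ℂⁿ`: a complex affine subspace of complex dimension one. -/
def IsComplexLine {n : ℕ} (l : AffineSubspace ℂ (Cn n)) : Prop :=
  Module.finrank ℂ l.direction = 1

/-- A domain in `ℂⁿ`: a (nonempty) connected open set. -/
def IsDomainCn {n : ℕ} (D : Set (Cn n)) : Prop :=
  IsOpen D ∧ IsConnected D

/-- `D` is `ℂ`-convex: the slice `D ∩ l` is simply connected (in particular connected) for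
every complex affine line `l` meeting `D`. If `D` is open, the slice is automatically open in `l`. -/
def IsCConvex {n : ℕ} (D : Set (Cn n)) : Prop :=
  ∀ l : AffineSubspace ℂ (Cn n), IsComplexLine l → (D ∩ (l : Set (Cn n))).Nonempty →
    IsSimplyConnected (D ∩ (l : Set (Cn n)))

/-- `D` is non-degenerate: it contains no complex affine line. -/
def IsNondegenerate {n : ℕ} (D : Set (Cn n)) : Prop :=
  ∀ l : AffineSubspace ℂ (Cn n), IsComplexLine l → ¬ (l : Set (Cn n)) ⊆ D

/-- `ψ` is a holomorphic map from the open set `U` into `V`. -/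
def IsHolomorphicInto {n : ℕ} (ψ : Cn n → Cn n) (U V : Set (Cn n)) : Prop :=
  DifferentiableOn ℂ ψ U ∧ Set.MapsTo ψ U V

/-- The open Euclidean unit ball of `ℂⁿ`. -/
def unitBall (n : ℕ) : Set (Cn n) := Metric.ball 0 1

/-- The complex Jacobian determinant `det ψ'(z)`. -/
noncomputable def jacobianDet {n : ℕ} (ψ : Cn n → Cn n) (z : Cn n) : ℂ :=
  (fderiv ℂ ψ z).det

/-- The Carathéodory volume element `c_D(z)`. -/
noncomputable def caratheodoryVolume {n : ℕ} (D : Set (Cn n)) (z : Cn n) : ℝ :=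
  sSup {r : ℝ | ∃ ψ : Cn n → Cn n, IsHolomorphicInto ψ D (unitBall n) ∧ ψ z = 0 ∧
    r = ‖jacobianDet ψ z‖ ^ 2}

/-- The Kobayashi–Eisenman volume element `k_D(z)`. A map with vanishing Jacobian determinant
at the origin would contribute `|0|⁻² = +∞` to the infimum, so such maps are left out. -/
noncomputable def kobayashiVolume {n : ℕ} (D : Set (Cn n)) (z : Cn n) : ℝ :=
  sInf {r : ℝ | ∃ ψ : Cn n → Cn n, IsHolomorphicInto ψ (unitBall n) D ∧ ψ 0 = z ∧
    jacobianDet ψ 0 ≠ 0 ∧ r = (‖jacobianDet ψ 0‖ ^ 2)⁻¹}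

/-- The quotient invariant `q_D(z) = c_D(z) / k_D(z)`, meaningful when `k_D(z) ≠ 0`. -/
noncomputable def quotientInvariant {n : ℕ} (D : Set (Cn n)) (z : Cn n) : ℝ :=
  caratheodoryVolume D z / kobayashiVolume D z

/-! Everything is read off from the set of omitted functionals: linear `l` such that the hyperplane
`l (w - z) = 1` misses `D`. This set is compact. It separates points because `D` is `ℂ`-convex and
contains no line. Auerbach's lemma, i.e. maximising the modulus of the determinant, picks `L 1, …, L
n` in it such that every omitted `l` satisfies `|l v| ≤ ∑ |L i v|`. Let `d` be the modulus of their
determinant.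

Upper bound for `k_D`. An ellipsoid centred at `z` that meets no omitted hyperplane lies in `D`:
otherwise shrink it until it touches the complement, and its complex tangent hyperplane there misses
`D`. This tangency fact is topological. If the hyperplane met `D`, a circle of complex lines through
the contact point would carry a continuous logarithm of `w ↦ A / w`, with `A ≠ 0`, on the unit
circle. The ellipsoid `∑ |L i v| ^ 2 < 1 / n` qualifies by Cauchy–Schwarz and gives `k_D ≤ n ^ n * d
^ 2`.

Lower bound for `c_D`. Each image `L i (D - z)` is an open plane set containing `0`, omitting `1`,
on which zero-free continuous functions have continuous logarithms. Koebe's quarter theorem maps it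
univalently into the disc, fixing `0`, with derivative at least any `c < 1 / 4`. These maps, scaled
by `1 / √n`, are the components of a map into the ball, so `c_D ≥ (1 / (16 n)) ^ n * d ^ 2`.

The factor `d ^ 2` cancels and `q_D ≥ (1 / (16 n ^ 2)) ^ n`; the stated constant is weaker, since `4
^ n - 1 ≥ 3 n`.

The quarter theorem is proved without the area theorem or the Riemann map: a near-extremal univalent
map covers almost the whole disc (square root trick), and its inverse is controlled by a Cauchy
determinant estimate at roots of unity. -/

open Filter Topology ComplexConjugate
open scoped Matrix

/-! ### Cauchy determinants and a sharp derivative bound -/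

/-- The Lagrange-type matrix `∏_{l ≠ k} (x_j + y_l)` has, up to absolute value, the determinant
`V(x) V(y)`, with `V` the Vandermonde determinant. -/
theorem norm_det_prod_add_eq {N : ℕ} (x y : Fin N → ℂ) (hy : Function.Injective y) :
    ‖(Matrix.of fun j k => ∏ l ∈ Finset.univ.erase k, (x j + y l)).det‖ =
      ‖(Matrix.vandermonde x).det‖ * ‖(Matrix.vandermonde y).det‖ := by
  classical
  let p : Fin N → Polynomial ℂ := fun k =>
    ∏ l ∈ Finset.univ.erase k, (Polynomial.X + Polynomial.C (y l))
  let B : Matrix (Fin N) (Fin N) ℂ := Matrix.of fun j k => (p k).coeff j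
  have hdeg : ∀ k, (p k).natDegree < N := by
    intro k
    have h1 : (p k).natDegree = (Finset.univ.erase k).card := by
      simp only [p]
      rw [Polynomial.natDegree_prod_of_monic _ _ (fun i _ => Polynomial.monic_X_add_C _)]
      simp
    rw [h1, Finset.card_erase_of_mem (Finset.mem_univ _), Finset.card_univ, Fintype.card_fin]
    have := k.pos
    omega
  have hmul : ∀ u : Fin N → ℂ, Matrix.vandermonde u * B =
      Matrix.of fun j k => ∏ l ∈ Finset.univ.erase k, (u j + y l) := by
    intro u
    ext j k
    have h2 : (p k).eval (u j) = ∏ l ∈ Finset.univ.erase k, (u j + y l) := by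
      simp [p, Polynomial.eval_prod]
    rw [Matrix.mul_apply, Matrix.of_apply, ← h2, Polynomial.eval_eq_sum_range' (hdeg k),
      ← Fin.sum_univ_eq_sum_range (fun i => (p k).coeff i * u j ^ i)]
    exact Finset.sum_congr rfl fun i _ => by simp [B, Matrix.vandermonde_apply, mul_comm]
  -- At the nodes `-y j` the polynomial `p k` vanishes unless `j = k`, so the product is diagonal.
  -- This computes `|det B|` once `V(y)` is cancelled, which needs `y` injective.
  have hneg : (Matrix.vandermonde (-y) * B).det =
      ∏ k, ∏ l ∈ Finset.univ.erase k, (y l - y k) := by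
    rw [hmul]
    have : (Matrix.of fun j k => ∏ l ∈ Finset.univ.erase k, ((-y) j + y l)) =
        Matrix.diagonal fun k => ∏ l ∈ Finset.univ.erase k, (y l - y k) := by
      ext j k
      rcases eq_or_ne j k with rfl | hjk
      · simp only [Matrix.of_apply, Matrix.diagonal_apply_eq]
        exact Finset.prod_congr rfl fun l _ => by simp; ring
      · rw [Matrix.of_apply, Matrix.diagonal_apply_ne _ hjk]
        exact Finset.prod_eq_zero (Finset.mem_erase.2 ⟨hjk, Finset.mem_univ j⟩) (by simp)
    rw [this, Matrix.det_diagonal]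
  have hsplit : ‖∏ k, ∏ l ∈ Finset.univ.erase k, (y l - y k)‖ =
      ‖(Matrix.vandermonde y).det‖ ^ 2 := by
    have h3 : ∀ k : Fin N, ∏ l ∈ Finset.univ.erase k, ‖y l - y k‖ =
        (∏ l ∈ Finset.Ioi k, ‖y l - y k‖) * ∏ l ∈ Finset.Iio k, ‖y l - y k‖ := by
      intro k
      rw [← Finset.prod_union]
      · refine Finset.prod_congr ?_ fun _ _ => rfl
        ext l
        simp only [Finset.mem_erase, Finset.mem_univ, and_true, Finset.mem_union,
          Finset.mem_Ioi, Finset.mem_Iio]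
        exact ⟨fun h => (lt_or_gt_of_ne h).symm, fun h => h.elim ne_of_gt ne_of_lt⟩
      · rw [Finset.disjoint_left]
        intro l h1 h2
        exact absurd (Finset.mem_Ioi.1 h1) (not_lt.2 (Finset.mem_Iio.1 h2).le)
    simp only [norm_prod, h3, Finset.prod_mul_distrib, Matrix.det_vandermonde, sq]
    congr 1
    rw [Finset.prod_comm' (s' := fun l => Finset.Ioi l) (t' := Finset.univ) (by simp)]
    exact Finset.prod_congr rfl fun _ _ => Finset.prod_congr rfl fun _ _ => norm_sub_rev _ _
  have hVneg : ‖(Matrix.vandermonde (-y)).det‖ = ‖(Matrix.vandermonde y).det‖ := by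
    simp only [Matrix.det_vandermonde, norm_prod, Pi.neg_apply]
    refine Finset.prod_congr rfl fun _ _ => Finset.prod_congr rfl fun _ _ => ?_
    rw [neg_sub_neg, norm_sub_rev]
  have hV0 : ‖(Matrix.vandermonde y).det‖ ≠ 0 :=
    norm_ne_zero_iff.2 (Matrix.det_vandermonde_ne_zero_iff.2 hy)
  have hB : ‖B.det‖ = ‖(Matrix.vandermonde y).det‖ := by
    have := congrArg norm hneg
    rw [Matrix.det_mul, norm_mul, hsplit, hVneg, sq] at this
    exact mul_left_cancel₀ hV0 this
  rw [← hmul, Matrix.det_mul, norm_mul, hB]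

/-- A determinant with entries bounded by `C` is at most `N! C ^ N`. -/
theorem norm_det_le_factorial_mul_pow {N : ℕ} (A : Matrix (Fin N) (Fin N) ℂ) {C : ℝ}
    (hA : ∀ i j, ‖A i j‖ ≤ C) : ‖A.det‖ ≤ N.factorial * C ^ N := by
  rw [Matrix.det_apply]
  refine (norm_sum_le _ _).trans ?_
  have : ∀ σ : Equiv.Perm (Fin N), ‖Equiv.Perm.sign σ • ∏ i, A (σ i) i‖ ≤ C ^ N := by
    intro σ
    have h1 : ‖Equiv.Perm.sign σ • ∏ i, A (σ i) i‖ = ∏ i, ‖A (σ i) i‖ := by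
      rcases Int.units_eq_one_or (Equiv.Perm.sign σ) with h | h <;> simp [h]
    rw [h1]
    refine (Finset.prod_le_prod (fun _ _ => norm_nonneg _) fun i _ => hA (σ i) i).trans ?_
    simp
  refine (Finset.sum_le_sum fun σ _ => this σ).trans ?_
  simp [Fintype.card_perm]

/-- The bound on the Cauchy determinant `V(x)² / ∏ (x_j + x_k)`. -/
theorem norm_vandermonde_sq_le {N : ℕ} (x : Fin N → ℂ) {C : ℝ}
    (hx : ∀ j k, x j + x k ≠ 0) (hC : ∀ j k, ‖(x j + x k)⁻¹‖ ≤ C) :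
    ‖(Matrix.vandermonde x).det ^ 2 * (∏ j, ∏ k, (x j + x k))⁻¹‖ ≤ N.factorial * C ^ N := by
  classical
  by_cases hinj : Function.Injective x
  · refine le_trans (le_of_eq ?_)
      (norm_det_le_factorial_mul_pow (Matrix.of fun j k => (x j + x k)⁻¹) (fun j k => hC j k))
    -- Pulling the common denominator out of each row turns the Cauchy matrix into the Lagrange-type
    -- matrix with `y = x`.
    have h1 : (Matrix.of fun j k => (x j + x k)⁻¹) =
        Matrix.of fun j k => (∏ l, (x j + x l))⁻¹ *
          (Matrix.of fun j k => ∏ l ∈ Finset.univ.erase k, (x j + x l)) j k := by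
      ext j k
      simp only [Matrix.of_apply]
      rw [← Finset.mul_prod_erase Finset.univ (fun l => x j + x l) (Finset.mem_univ k), mul_inv,
        mul_assoc, inv_mul_cancel₀, mul_one]
      exact Finset.prod_ne_zero_iff.2 fun l _ => hx j l
    rw [h1, Matrix.det_mul_column, norm_mul, norm_mul, norm_det_prod_add_eq x x hinj, norm_pow, sq,
      mul_comm, Finset.prod_inv_distrib]
  · have : (Matrix.vandermonde x).det = 0 := by
      by_contra h
      exact hinj (Matrix.det_vandermonde_ne_zero_iff.1 h)
    rw [this]
    have hC0 : 0 ≤ C ∨ N = 0 := by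
      rcases Nat.eq_zero_or_pos N with h | h
      · exact Or.inr h
      · exact Or.inl ((norm_nonneg _).trans (hC ⟨0, h⟩ ⟨0, h⟩))
    rcases hC0 with h | h
    · simp only [ne_eq, OfNat.ofNat_ne_zero, not_false_eq_true, zero_pow, zero_mul, norm_zero]
      positivity
    · subst h; simp

/-- The rows are orthogonal characters of the cyclic group, so `V * Vᴴ = N • 1`. -/
theorem norm_vandermonde_rootsOfUnity_sq {N : ℕ} {ω : ℂ} (hω : IsPrimitiveRoot ω N)
    (hN : N ≠ 0) :
    ‖(Matrix.vandermonde fun i : Fin N => ω ^ (i : ℕ)).det‖ ^ 2 = (N : ℝ) ^ N := by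
  have hn1 : ‖ω‖ = 1 := hω.norm'_eq_one hN
  have h0 : ω ≠ 0 := hω.ne_zero hN
  have hbar : (starRingEnd ℂ) ω = ω⁻¹ := by
    rw [Complex.inv_def, Complex.normSq_eq_norm_sq, hn1]; simp
  set V := Matrix.vandermonde fun i : Fin N => ω ^ (i : ℕ)
  have hVV : V * V.conjTranspose = (N : ℂ) • (1 : Matrix (Fin N) (Fin N) ℂ) := by
    ext i j
    rw [Matrix.mul_apply]
    have hterm : ∀ k : Fin N, V i k * V.conjTranspose k j = (ω ^ (i : ℕ) * (ω ^ (j : ℕ))⁻¹) ^ (k : ℕ) := by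
      intro k
      simp [V, Matrix.conjTranspose_apply, Matrix.vandermonde_apply, hbar, mul_pow]
    simp only [hterm]
    rw [Fin.sum_univ_eq_sum_range (fun k => (ω ^ (i : ℕ) * (ω ^ (j : ℕ))⁻¹) ^ k)]
    rcases eq_or_ne i j with rfl | hij
    · simp [h0]
    · have hne : ω ^ (i : ℕ) * (ω ^ (j : ℕ))⁻¹ ≠ 1 := by
        intro h
        apply hij
        have : ω ^ (i : ℕ) = ω ^ (j : ℕ) := by
          have := mul_inv_eq_one₀ (pow_ne_zero (j : ℕ) h0) |>.1 h
          exact this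
        exact Fin.ext (hω.pow_inj i.2 j.2 this)
      rw [geom_sum_eq hne, mul_pow, ← pow_mul, inv_pow, ← pow_mul, mul_comm (i : ℕ),
        mul_comm (j : ℕ), pow_mul, pow_mul, hω.pow_eq_one]
      simp [hij]
  have := congrArg (fun A => ‖Matrix.det A‖) hVV
  simp only [Matrix.det_mul, Matrix.det_conjTranspose, norm_mul, norm_star, Matrix.det_smul,
    Matrix.det_one, mul_one, norm_pow, Fintype.card_fin, Complex.norm_natCast] at this
  rw [sq, this]

/-- A real number with powers bounded above is at most one. -/
theorem le_one_of_forall_pow_le {a K : ℝ} (h : ∀ m : ℕ, a ^ m ≤ K) : a ≤ 1 := by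
  by_contra! ha
  obtain ⟨m, hm⟩ := pow_unbounded_of_one_lt K ha
  exact absurd (h m) (not_le.2 hm)

/-- A function `F` on a neighbourhood of the closed unit disc with `F 0 = 1` whose image is disjoint
from its negative satisfies `|F' 0| ≤ 2`. -/
theorem norm_deriv_le_two_of_add_ne_zero {F : ℂ → ℂ} {R : ℝ} (hR : 1 < R)
    (hF : DifferentiableOn ℂ F (Metric.ball 0 R)) (h0 : F 0 = 1)
    (hadd : ∀ z ∈ Metric.ball (0 : ℂ) R, ∀ w ∈ Metric.ball (0 : ℂ) R, F z + F w ≠ 0) :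
    ‖deriv F 0‖ ≤ 2 := by
  have hsub : Metric.closedBall (0 : ℂ) 1 ⊆ Metric.ball 0 R := Metric.closedBall_subset_ball hR
  obtain ⟨C, hC⟩ : ∃ C : ℝ, ∀ z ∈ Metric.closedBall (0 : ℂ) 1, ∀ w ∈ Metric.closedBall (0 : ℂ) 1,
      ‖(F z + F w)⁻¹‖ ≤ C := by
    have hcomp : IsCompact (Metric.closedBall (0 : ℂ) 1 ×ˢ Metric.closedBall (0 : ℂ) 1) :=
      (isCompact_closedBall _ _).prod (isCompact_closedBall _ _)
    have hcont : ContinuousOn (fun p : ℂ × ℂ => (F p.1 + F p.2)⁻¹)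
        (Metric.closedBall (0 : ℂ) 1 ×ˢ Metric.closedBall (0 : ℂ) 1) := by
      refine ContinuousOn.inv₀ (ContinuousOn.add ?_ ?_) ?_
      · exact hF.continuousOn.comp continuousOn_fst fun p hp => hsub hp.1
      · exact hF.continuousOn.comp continuousOn_snd fun p hp => hsub hp.2
      · exact fun p hp => hadd _ (hsub hp.1) _ (hsub hp.2)
    obtain ⟨C, hC⟩ := hcomp.exists_bound_of_continuousOn hcont
    exact ⟨C, fun z hz w hw => hC (z, w) ⟨hz, hw⟩⟩
  have hd0 : HasDerivAt F (deriv F 0) 0 :=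
    (hF.differentiableAt (Metric.ball_mem_nhds _ (by linarith))).hasDerivAt
  have key : ∀ m : ℕ, ‖deriv F 0‖ ^ m ≤ 2 ^ (m + 1) * C := by
    intro m
    set N := m + 1 with hNdef
    have hN : N ≠ 0 := Nat.succ_ne_zero m
    obtain ⟨ω, hω⟩ : ∃ ω : ℂ, IsPrimitiveRoot ω N := ⟨_, Complex.isPrimitiveRoot_exp N hN⟩
    have hωn : ‖ω‖ = 1 := hω.norm'_eq_one hN
    have hmem : ∀ ρ ∈ Metric.ball (0 : ℂ) R, ∀ i : ℕ, ρ * ω ^ i ∈ Metric.ball (0 : ℂ) R := by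
      intro ρ hρ i
      simpa [hωn] using hρ
    have hmem1 : ∀ ρ ∈ Metric.closedBall (0 : ℂ) 1, ∀ i : ℕ,
        ρ * ω ^ i ∈ Metric.closedBall (0 : ℂ) 1 := by
      intro ρ hρ i
      simpa [hωn] using hρ
    have hFd : ∀ i : ℕ, DifferentiableOn ℂ (fun ρ => F (ρ * ω ^ i)) (Metric.ball 0 R) := fun i =>
      hF.comp (by fun_prop) fun ρ hρ => hmem ρ hρ i
    -- The quotient `(F (ρ ω^j) - F (ρ ω^i)) / ρ`, extended holomorphically over `ρ = 0` by `F'(0)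
    -- (ω^j - ω^i)`.
    let D : ℕ → ℕ → ℂ → ℂ := fun i j => dslope (fun ρ => F (ρ * ω ^ j) - F (ρ * ω ^ i)) 0
    have hDd : ∀ i j, DifferentiableOn ℂ (D i j) (Metric.ball 0 R) := fun i j =>
      (Complex.differentiableOn_dslope (Metric.ball_mem_nhds _ (by linarith))).2
        ((hFd j).sub (hFd i))
    -- On `|ρ| = 1` this has the modulus of the Cauchy determinant of the values `F (ρ ω^j)`; the
    -- maximum principle carries the bound `N! C ^ N` to `ρ = 0`, where `H` involves only `F'(0)`.
    let H : ℂ → ℂ := fun ρ => (∏ i : Fin N, ∏ j ∈ Finset.Ioi i, D i j ρ) ^ 2 *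
      (∏ j : Fin N, ∏ k : Fin N, (F (ρ * ω ^ (j : ℕ)) + F (ρ * ω ^ (k : ℕ))))⁻¹
    have hHd : DifferentiableOn ℂ H (Metric.ball 0 R) := by
      refine DifferentiableOn.mul (DifferentiableOn.pow ?_ 2) (DifferentiableOn.inv ?_ ?_)
      · exact DifferentiableOn.fun_finsetProd fun i _ =>
          DifferentiableOn.fun_finsetProd fun j _ => hDd i j
      · exact DifferentiableOn.fun_finsetProd fun i _ =>
          DifferentiableOn.fun_finsetProd fun j _ => (hFd i).add (hFd j)
      · exact fun ρ hρ => Finset.prod_ne_zero_iff.2 fun i _ => Finset.prod_ne_zero_iff.2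
          fun j _ => hadd _ (hmem ρ hρ i) _ (hmem ρ hρ j)
    have hbound : ∀ ρ ∈ Metric.sphere (0 : ℂ) 1, ‖H ρ‖ ≤ N.factorial * C ^ N := by
      intro ρ hρ
      have hρ1 : ‖ρ‖ = 1 := by simpa using hρ
      have hρ0 : ρ ≠ 0 := by rintro rfl; simp at hρ1
      have hρb := Metric.sphere_subset_closedBall hρ
      have hV : ‖∏ i : Fin N, ∏ j ∈ Finset.Ioi i, D i j ρ‖ =
          ‖(Matrix.vandermonde fun i : Fin N => F (ρ * ω ^ (i : ℕ))).det‖ := by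
        rw [Matrix.det_vandermonde]
        simp only [norm_prod]
        refine Finset.prod_congr rfl fun i _ => Finset.prod_congr rfl fun j _ => ?_
        simp [D, dslope_of_ne _ hρ0, slope_def_field, hρ1]
      have := norm_vandermonde_sq_le (fun i : Fin N => F (ρ * ω ^ (i : ℕ))) (C := C)
        (fun j k => hadd _ (hsub (hmem1 ρ hρb j)) _ (hsub (hmem1 ρ hρb k)))
        (fun j k => hC _ (hmem1 ρ hρb j) _ (hmem1 ρ hρb k))
      simp only [H]
      rw [norm_mul, norm_pow, hV, ← norm_pow, ← norm_mul]
      exact this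
    have hmax : ‖H 0‖ ≤ N.factorial * C ^ N := by
      refine Complex.norm_le_of_forall_mem_frontier_norm_le (U := Metric.ball (0 : ℂ) 1)
        Metric.isBounded_ball ?_ ?_ (subset_closure (by simp))
      · refine DifferentiableOn.diffContOnCl ?_
        rw [closure_ball _ one_ne_zero]
        exact hHd.mono hsub
      · rw [frontier_ball _ one_ne_zero]
        exact hbound
    have hD0 : ∀ i j, D i j 0 = deriv F 0 * (ω ^ j - ω ^ i) := by
      intro i j
      have hd : ∀ i : ℕ, HasDerivAt (fun ρ => F (ρ * ω ^ i)) (deriv F 0 * ω ^ i) 0 := by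
        intro i
        have h1 : HasDerivAt (fun ρ : ℂ => ρ * ω ^ i) (ω ^ i) 0 := by
          simpa using (hasDerivAt_id (0 : ℂ)).mul_const (ω ^ i)
        have h2 : HasDerivAt F (deriv F 0) ((fun ρ : ℂ => ρ * ω ^ i) 0) := by simpa using hd0
        exact h2.comp 0 h1
      simp only [D, dslope_same]
      rw [((hd j).fun_sub (hd i)).deriv]
      ring
    have hV0 : ‖∏ i : Fin N, ∏ j ∈ Finset.Ioi i, D i j 0‖ ^ 2 =
        ‖deriv F 0‖ ^ (N * m) * (N : ℝ) ^ N := by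
      rw [← norm_vandermonde_rootsOfUnity_sq hω hN, Matrix.det_vandermonde]
      simp only [hD0, Finset.prod_mul_distrib, norm_mul, mul_pow]
      congr 1
      simp only [Finset.prod_const, Fin.card_Ioi, Finset.prod_pow_eq_pow_sum, norm_pow]
      rw [← pow_mul]
      congr 1
      rw [Fin.sum_univ_eq_sum_range (fun i => N - 1 - i), Finset.sum_range_reflect (fun i => i),
        Finset.sum_range_id_mul_two, hNdef, Nat.add_sub_cancel]
    have hH0 : ‖H 0‖ = ‖deriv F 0‖ ^ (N * m) * (N : ℝ) ^ N * ((2 : ℝ) ^ (N * N))⁻¹ := by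
      simp only [H]
      rw [norm_mul, norm_pow, hV0, norm_inv]
      congr 2
      simp only [zero_mul, h0, Finset.prod_const, Finset.card_univ, Fintype.card_fin]
      norm_num [← pow_mul]
    -- The factor `N ^ N` in `H 0` absorbs `N!`, so that `N`-th roots leave only the constant `C`.
    have hfac : (N.factorial : ℝ) ≤ (N : ℝ) ^ N := by exact_mod_cast Nat.factorial_le_pow N
    have hC0 : 0 ≤ C := (norm_nonneg _).trans (hC 0 (by simp) 0 (by simp))
    have hNpos : (0 : ℝ) < (N : ℝ) ^ N := by positivity
    have h2 : ‖deriv F 0‖ ^ (N * m) * (N : ℝ) ^ N * ((2 : ℝ) ^ (N * N))⁻¹ ≤ (N : ℝ) ^ N * C ^ N := by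
      rw [← hH0]
      exact hmax.trans (mul_le_mul_of_nonneg_right hfac (by positivity))
    have h3 : (‖deriv F 0‖ ^ m) ^ N ≤ (2 ^ (m + 1) * C) ^ N := by
      rw [← pow_mul, mul_comm m N, mul_pow, ← pow_mul, ← hNdef]
      rw [mul_inv_le_iff₀ (by positivity)] at h2
      refine le_of_mul_le_mul_right ?_ hNpos
      calc _ ≤ _ := h2
        _ = _ := by ring
    exact le_of_pow_le_pow_left₀ hN (by positivity) h3
  -- The constant `2 * C` does not depend on `m`, so letting `m` grow removes it.
  have h4 : ‖deriv F 0‖ / 2 ≤ 1 := by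
    refine le_one_of_forall_pow_le (K := 2 * C) fun m => ?_
    rw [div_pow, div_le_iff₀ (by positivity)]
    calc _ ≤ _ := key m
      _ = _ := by ring
  linarith

/-! ### Continuous logarithms in families -/

/-- A continuous function with constant exponential on a preconnected set is constant there. -/
theorem IsPreconnected.eq_of_exp_eq {X : Type*} [TopologicalSpace X] {s : Set X}
    (hs : IsPreconnected s) {f : X → ℂ} (hf : ContinuousOn f s) {c : ℂ}
    (h : ∀ x ∈ s, Complex.exp (f x) = c) {x y : X} (hx : x ∈ s) (hy : y ∈ s) : f x = f y := by
  have hc : c ∈ ({0}ᶜ : Set ℂ) := by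
    rw [← h x hx]
    exact Complex.exp_ne_zero _
  have hdisc : IsDiscrete (Complex.exp ⁻¹' {c}) :=
    ⟨(Complex.isCoveringMapOn_exp c hc).discreteTopology_fiber⟩
  exact hs.constant_of_mapsTo hdisc hf (fun x hx => h x hx) hx hy

/-- Canonical logarithms in families: if the fibres of an open set `S ⊆ X × ℂ` are simply connected,
and `F` is continuous without zeros on `S`, the ratio of the values of `F` along two sections of `S`
has a continuous logarithm. -/
theorem exists_continuous_log_ratio {X : Type*} [TopologicalSpace X] {S : Set (X × ℂ)}
    (hS : IsOpen S) (hsc : ∀ x, IsSimplyConnected {t : ℂ | (x, t) ∈ S}) {F : X × ℂ → ℂ}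
    (hF : ContinuousOn F S) (hF0 : ∀ p ∈ S, F p ≠ 0) {a b : X → ℂ} (ha : Continuous a)
    (hb : Continuous b) (haS : ∀ x, (x, a x) ∈ S) (hbS : ∀ x, (x, b x) ∈ S) :
    ∃ c : X → ℂ, Continuous c ∧ ∀ x, Complex.exp (c x) * F (x, a x) = F (x, b x) := by
  have hlog : ∀ x, ∃ g : ℂ → ℂ, ContinuousOn g {t : ℂ | (x, t) ∈ S} ∧
      ∀ t, (x, t) ∈ S → Complex.exp (g t) = F (x, t) := by
    intro x
    obtain ⟨g, hg, hgF⟩ := Complex.exists_continuousOn_eqOn_exp_comp (hsc x)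
      (hS.preimage (by fun_prop : Continuous fun t : ℂ => (x, t))) (g := fun t => F (x, t))
      (hF.comp (by fun_prop) fun t ht => ht)
      (by rintro ⟨t, ht, h0⟩; exact hF0 _ ht h0)
    exact ⟨g, hg, fun t ht => hgF ht⟩
  choose g hg hgF using hlog
  -- The increment of a logarithm inside one fibre does not depend on the branch, so the unrelated
  -- choices `g x` can still give a continuous function of `x`.
  refine ⟨fun x => g x (b x) - g x (a x), ?_, fun x => ?_⟩
  swap
  · rw [Complex.exp_sub, hgF x _ (hbS x), hgF x _ (haS x), div_mul_cancel₀ _ (hF0 _ (haS x))]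
  rw [continuous_iff_continuousAt]
  intro x₀
  obtain ⟨γ, hγ⟩ := (hsc x₀).isPathConnected.joinedIn _ (haS x₀) _ (hbS x₀)
  -- A path joining the two sections over `x₀`, deformed so that over `x` it runs from `a x` to `b
  -- x`. By compactness it stays in `S` for `x` near `x₀`.
  let Γ : X × unitInterval → ℂ := fun p =>
    γ p.2 + (1 - (p.2 : ℝ) : ℂ) * (a p.1 - a x₀) + ((p.2 : ℝ) : ℂ) * (b p.1 - b x₀)
  have hΓ : Continuous Γ := by fun_prop
  have hΓ₀ : ∀ t, Γ (x₀, t) = γ t := fun t => by simp [Γ]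
  let u : X × unitInterval → ℂ := fun p => F (p.1, Γ p) / F (x₀, γ p.2)
  have hpre : ∀ p : X × unitInterval, (p.1, Γ p) ∈ S → ContinuousAt u p := by
    intro p hp
    have h1 : ContinuousAt (fun p : X × unitInterval => F (p.1, Γ p)) p :=
      ContinuousAt.comp (g := F) (hF.continuousAt (hS.mem_nhds hp)) (by fun_prop)
    have h2 : ContinuousAt (fun p : X × unitInterval => F (x₀, γ p.2)) p :=
      ContinuousAt.comp (g := F) (f := fun p : X × unitInterval => (x₀, γ p.2))
        (hF.continuousAt (hS.mem_nhds (hγ p.2))) (by fun_prop)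
    exact h1.div h2 (hF0 _ (hγ p.2))
  rw [Metric.continuousAt_iff']
  intro δ hδ
  let W : Set ℂ := {w | w ∈ Complex.slitPlane ∧ ‖Complex.log w‖ < δ / 2}
  have hW : W ∈ 𝓝 (1 : ℂ) := by
    refine Filter.inter_mem (Complex.isOpen_slitPlane.mem_nhds (by simp)) ?_
    have : ContinuousAt (fun w => ‖Complex.log w‖) 1 := (continuousAt_clog (by simp)).norm
    exact this.eventually (gt_mem_nhds (by simpa using hδ))
  have hev : ∀ᶠ x in 𝓝 x₀, ∀ t ∈ (Set.univ : Set unitInterval),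
      (x, Γ (x, t)) ∈ S ∧ u (x, t) ∈ W := by
    refine isCompact_univ.eventually_forall_of_forall_eventually fun t _ => ?_
    have hmem : (x₀, Γ (x₀, t)) ∈ S := by rw [hΓ₀]; exact hγ t
    have h1 : ∀ᶠ p : X × unitInterval in 𝓝 (x₀, t), (p.1, Γ p) ∈ S :=
      (by fun_prop : ContinuousAt (fun p : X × unitInterval => (p.1, Γ p)) (x₀, t)).eventually
        (hS.mem_nhds hmem)
    have h2 : ∀ᶠ p : X × unitInterval in 𝓝 (x₀, t), u p ∈ W := by
      refine (hpre (x₀, t) hmem).eventually ?_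
      have : u (x₀, t) = 1 := by
        simp only [u, hΓ₀]
        exact div_self (hF0 _ (hγ t))
      rw [this]
      exact hW
    exact h1.and h2
  filter_upwards [hev] with x hx
  -- Along the path the two logarithms differ by the small principal logarithm of `u` plus a
  -- constant. The increments over `x` and `x₀` therefore differ only by the two endpoint values of
  -- that logarithm.
  have hd : ∀ t : unitInterval, g x (Γ (x, t)) - g x₀ (γ t) - Complex.log (u (x, t)) =
      g x (Γ (x, 0)) - g x₀ (γ 0) - Complex.log (u (x, 0)) := by
    intro t
    refine isPreconnected_univ.eq_of_exp_eq (c := 1)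
      (f := fun t : unitInterval => g x (Γ (x, t)) - g x₀ (γ t) - Complex.log (u (x, t)))
      ?_ ?_ (Set.mem_univ t) (Set.mem_univ 0)
    · refine (ContinuousOn.sub ?_ ?_).sub ?_
      · exact (hg x).comp (by fun_prop) fun t _ => (hx t trivial).1
      · exact (hg x₀).comp (by fun_prop) fun t _ => hγ t
      · refine ContinuousOn.clog (fun t _ => ?_) fun t _ => (hx t trivial).2.1
        exact (ContinuousAt.comp (f := fun t : unitInterval => (x, t))
          (hpre (x, t) (hx t trivial).1) (by fun_prop)).continuousWithinAt
    · intro t _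
      have h1 := hF0 _ (hx t trivial).1
      have h2 := hF0 _ (hγ t)
      rw [Complex.exp_sub, Complex.exp_sub, hgF _ _ (hx t trivial).1, hgF _ _ (hγ t),
        Complex.exp_log (Complex.slitPlane_ne_zero (hx t trivial).2.1)]
      exact div_self (div_ne_zero h1 h2)
  have h1 := hd 1
  have e0 : Γ (x, 0) = a x := by simp [Γ]
  have e1 : Γ (x, 1) = b x := by simp [Γ]
  rw [e0, e1, γ.source, γ.target] at h1
  have h2 : g x (b x) - g x (a x) - (g x₀ (b x₀) - g x₀ (a x₀)) =
      Complex.log (u (x, 1)) - Complex.log (u (x, 0)) := by linear_combination h1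
  rw [dist_eq_norm, h2]
  refine (norm_sub_le _ _).trans_lt ?_
  linarith [(hx 0 trivial).2.2, (hx 1 trivial).2.2]

/-- Every continuous function without zeros on `U` has a continuous logarithm on `U`. -/
def HasContinuousLogs {X : Type*} [TopologicalSpace X] (U : Set X) : Prop :=
  ∀ g : X → ℂ, ContinuousOn g U → (∀ x ∈ U, g x ≠ 0) →
    ∃ f : X → ℂ, ContinuousOn f U ∧ ∀ x ∈ U, Complex.exp (f x) = g x

/-! ### Topology of `ℂ`-convex sets: logarithms and tangent hyperplanes -/

section CConvex

variable {n : ℕ} {D : Set (Cn n)}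

/-- The parametrized slices of a `ℂ`-convex set by complex lines are simply connected. -/
theorem IsCConvex.isSimplyConnected_slice (hC : IsCConvex D) {p v : Cn n} (hv : v ≠ 0)
    (hne : ∃ t : ℂ, p + t • v ∈ D) : IsSimplyConnected {t : ℂ | p + t • v ∈ D} := by
  have hemb : IsEmbedding fun t : ℂ => p + t • v :=
    (Homeomorph.addLeft p).isEmbedding.comp (isClosedEmbedding_smul_left hv).isEmbedding
  rw [← hemb.isSimplyConnected_image]
  let l : AffineSubspace ℂ (Cn n) := AffineSubspace.mk' p (ℂ ∙ v)
  have hl : ∀ x, x ∈ l ↔ ∃ t : ℂ, p + t • v = x := by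
    intro x
    rw [AffineSubspace.mem_mk', Submodule.mem_span_singleton]
    refine exists_congr fun t => ?_
    rw [vsub_eq_sub, eq_sub_iff_add_eq, add_comm]
  have himg : (fun t : ℂ => p + t • v) '' {t : ℂ | p + t • v ∈ D} = D ∩ (l : Set (Cn n)) := by
    ext x
    simp only [Set.mem_image, Set.mem_ofPred_eq, Set.mem_inter_iff, SetLike.mem_coe, hl]
    constructor
    · rintro ⟨t, ht, rfl⟩
      exact ⟨ht, t, rfl⟩
    · rintro ⟨hx, t, rfl⟩
      exact ⟨t, hx, rfl⟩
  rw [himg]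
  refine hC l ?_ ?_
  · rw [IsComplexLine, AffineSubspace.direction_mk', finrank_span_singleton hv]
  · obtain ⟨t, ht⟩ := hne
    exact ⟨_, ht, (hl _).2 ⟨t, rfl⟩⟩

/-- The complex lines through a base point `x₀` and a variable point `y` sweep out `D`; the
logarithm at `y` is the increment from `x₀` to `y` inside that slice. For `y = x₀` the line
degenerates and the fibre is all of `ℂ`. -/
theorem IsCConvex.hasContinuousLogs (hC : IsCConvex D) (hD : IsOpen D) : HasContinuousLogs D := by
  intro g hg hg0
  rcases D.eq_empty_or_nonempty with rfl | ⟨x₀, hx₀⟩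
  · exact ⟨0, by simp, by simp⟩
  let S : Set (D × ℂ) := {p | x₀ + p.2 • ((p.1 : Cn n) - x₀) ∈ D}
  have hS : IsOpen S := hD.preimage (by fun_prop)
  have hsc : ∀ y : D, IsSimplyConnected {t : ℂ | (y, t) ∈ S} := by
    intro y
    by_cases hy : (y : Cn n) - x₀ = 0
    · have : {t : ℂ | (y, t) ∈ S} = Set.univ := by
        ext t
        simp [S, hy, hx₀]
      rw [this]
      exact (Homeomorph.Set.univ ℂ).toHomotopyEquiv.simplyConnectedSpace
    · have : {t : ℂ | (y, t) ∈ S} = {t : ℂ | x₀ + t • ((y : Cn n) - x₀) ∈ D} :=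
        Set.ext fun t => Iff.rfl
      rw [this]
      exact hC.isSimplyConnected_slice hy ⟨0, by simpa using hx₀⟩
  obtain ⟨c, hc, hcF⟩ := exists_continuous_log_ratio hS hsc
    (F := fun p => g (x₀ + p.2 • ((p.1 : Cn n) - x₀)))
    (hg.comp (by fun_prop) fun p hp => hp) (fun p hp => hg0 _ hp)
    (a := fun _ => 0) (b := fun _ => 1) continuous_const continuous_const
    (fun y => by simpa [S] using hx₀) (fun y => by simp [S])
  classical
  refine ⟨fun y => if hy : y ∈ D then c ⟨y, hy⟩ + Complex.log (g x₀) else 0, ?_, fun y hy => ?_⟩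
  · rw [continuousOn_iff_continuous_domRestrict]
    have : (D.domRestrict fun y => if hy : y ∈ D then c ⟨y, hy⟩ + Complex.log (g x₀) else 0) =
        fun y => c y + Complex.log (g x₀) := by
      ext y
      simp
    rw [this]
    fun_prop
  · have := hcF ⟨y, hy⟩
    simp only [zero_smul, add_zero, one_smul, add_sub_cancel] at this
    simp only [dif_pos hy]
    rw [Complex.exp_add, Complex.exp_log (hg0 _ hx₀), this]

/-- Continuous logarithms descend to images of `ℂ`-convex sets under linear functionals. -/
theorem IsCConvex.hasContinuousLogs_image (hC : IsCConvex D) (hD : IsOpen D) (z : Cn n)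
    {l : Cn n →L[ℂ] ℂ} (hl : l ≠ 0) : HasContinuousLogs ((fun w => l (w - z)) '' D) := by
  intro g hg hg0
  obtain ⟨h, hh, hhg⟩ := hC.hasContinuousLogs hD (fun w => g (l (w - z)))
    (hg.comp (by fun_prop) fun w hw => Set.mem_image_of_mem _ hw)
    (fun w hw => hg0 _ (Set.mem_image_of_mem _ hw))
  -- The line through `w₁` and `w₂` lies in a fibre of `l`. Its slice of `D` is connected and `exp ∘
  -- h` is constant on it, hence so is `h`.
  have hfib : ∀ w₁ ∈ D, ∀ w₂ ∈ D, l (w₁ - z) = l (w₂ - z) → h w₁ = h w₂ := by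
    intro w₁ h₁ w₂ h₂ h12
    rcases eq_or_ne (w₂ - w₁) 0 with h0 | h0
    · rw [sub_eq_zero.1 h0]
    have hsc := hC.isSimplyConnected_slice (p := w₁) h0 ⟨0, by simpa using h₁⟩
    have hl0 : l (w₂ - w₁) = 0 := by
      have : w₂ - w₁ = (w₂ - z) - (w₁ - z) := by abel
      rw [this, map_sub, h12, sub_self]
    have := hsc.isPathConnected.isConnected.isPreconnected.eq_of_exp_eq
      (f := fun t : ℂ => h (w₁ + t • (w₂ - w₁))) (c := g (l (w₁ - z)))
      (hh.comp (by fun_prop) fun t ht => ht)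
      (fun t ht => by
        rw [hhg _ ht, add_sub_right_comm, map_add, map_smul, hl0, smul_zero, add_zero])
      (x := 0) (y := 1) (by simpa using h₁) (by simpa using h₂)
    simpa using this
  obtain ⟨e, he⟩ : ∃ e, l e = 1 := by
    obtain ⟨v, hv⟩ : ∃ v, l v ≠ 0 := by
      by_contra! hcon
      exact hl (ContinuousLinearMap.ext hcon)
    exact ⟨(l v)⁻¹ • v, by simp [hv]⟩
  -- The section `s` need not be continuous; near `u₀` it is replaced by the affine section in
  -- direction `e`, with the same value of `h`.
  choose! s hsD hsl using fun u (hu : u ∈ (fun w => l (w - z)) '' D) => hu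
  refine ⟨fun u => h (s u), ?_, fun u hu => ?_⟩
  · intro u₀ hu₀
    have hcont : ContinuousAt (fun u => s u₀ + (u - u₀) • e) u₀ := by fun_prop
    have hval : s u₀ + (u₀ - u₀) • e = s u₀ := by simp
    have hev : ∀ᶠ u in 𝓝 u₀, s u₀ + (u - u₀) • e ∈ D :=
      hcont.eventually (by simpa using hD.mem_nhds (hsD u₀ hu₀))
    have h1 : ContinuousAt (fun u => h (s u₀ + (u - u₀) • e)) u₀ :=
      ContinuousAt.comp (g := h)
        (by rw [hval]; exact hh.continuousAt (hD.mem_nhds (hsD u₀ hu₀))) hcont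
    refine (h1.congr ?_).continuousWithinAt
    filter_upwards [hev] with u hu
    have hlu : l (s u₀ + (u - u₀) • e - z) = u := by
      have := hsl u₀ hu₀
      simp only at this
      rw [add_sub_right_comm, map_add, this, map_smul, he]
      simp
    have huG : u ∈ (fun w => l (w - z)) '' D := ⟨_, hu, hlu⟩
    exact hfib _ hu _ (hsD u huG) (hlu.trans (hsl u huG).symm)
  · rw [hhg _ (hsD u hu)]
    exact congrArg g (hsl u hu)

/-- There is no continuous logarithm of `w ↦ A w⁻¹` on the unit circle. -/
theorem not_exists_continuous_log_circle (A : ℂ) (c : Circle → ℂ) (hc : Continuous c)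
    (h : ∀ w : Circle, Complex.exp (c w) = A * (w : ℂ)⁻¹) : False := by
  -- Adding `i t` makes the exponential constant, yet the values at `0` and `2π` differ by `2πi`.
  have hcont : Continuous fun t : ℝ => c (Circle.exp t) + t * Complex.I := by fun_prop
  have := isPreconnected_univ.eq_of_exp_eq (c := A) hcont.continuousOn
    (fun t _ => by
      rw [Complex.exp_add, h, Circle.coe_exp, mul_assoc, inv_mul_cancel₀ (Complex.exp_ne_zero _),
        mul_one])
    (Set.mem_univ 0) (Set.mem_univ (2 * Real.pi))
  simp [Circle.exp_two_pi, Real.pi_ne_zero] at this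

/-- If an ellipsoid is contained in the `ℂ`-convex set `D` and touches the complement of `D`, its
complex tangent hyperplane at the contact point misses `D`. -/
theorem IsCConvex.notMem_of_tangent (hC : IsCConvex D) (hD : IsOpen D) (T : Cn n ≃L[ℂ] Cn n)
    {z u y : Cn n} {ρ : ℝ} (hρ : 0 < ρ) (hball : ∀ w, ‖w‖ < ρ → z + T w ∈ D) (hu : ‖u‖ = ρ)
    (hp : z + T u ∉ D) (hy : inner ℂ u y = 0) : z + T (u + y) ∉ D := by
  intro hq
  have hy0 : y ≠ 0 := by
    rintro rfl
    exact hp (by simpa using hq)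
  obtain ⟨ε, hε, hεD⟩ : ∃ ε > 0, ∀ τ : ℂ, ‖τ‖ ≤ ε → z + T (u + (y + τ • u)) ∈ D := by
    have hcont : ContinuousAt (fun τ : ℂ => z + T (u + (y + τ • u))) 0 := by fun_prop
    have hev := hcont.eventually (hD.mem_nhds (by simpa using hq))
    obtain ⟨ε, hε, h⟩ := Metric.eventually_nhds_iff_ball.1 hev
    exact ⟨ε / 2, by linarith, fun τ hτ => h τ (by simp; linarith)⟩
  have hden : 0 < ρ ^ 2 * ε ^ 2 + ‖y‖ ^ 2 := by positivity
  -- The minimiser of `(1 - κ ε ^ 2) ^ 2 ρ ^ 2 + (κ ε) ^ 2 ‖y‖ ^ 2`; the minimum `ρ ^ 2 - κ ε ^ 2 ρ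
  -- ^ 2` is less than `ρ ^ 2`.
  set κ : ℝ := ρ ^ 2 / (ρ ^ 2 * ε ^ 2 + ‖y‖ ^ 2) with hκ
  have hκ0 : 0 < κ := by positivity
  have hκm : κ * (ρ ^ 2 * ε ^ 2 + ‖y‖ ^ 2) = ρ ^ 2 := div_mul_cancel₀ _ hden.ne'
  -- A circle of lines through the contact point, with directions turning around the tangent
  -- direction `T y`. Parameter `1` lands near `z + T (u + y)`, parameter `-κ ε / w` inside the
  -- ellipsoid, and parameter `0` outside `D`. The ratio of the two parameters winds once around
  -- `0`.
  let S : Set (Circle × ℂ) := {p | (z + T u) + p.2 • T (y + ((ε : ℂ) * p.1) • u) ∈ D}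
  have hS : IsOpen S := hD.preimage (by fun_prop)
  have haS : ∀ w : Circle, (w, (1 : ℂ)) ∈ S := by
    intro w
    have := hεD (ε * w) (by simp [abs_of_pos hε, Circle.norm_coe])
    simpa only [S, Set.mem_ofPred_eq, one_smul, map_add, add_assoc] using this
  have hbS : ∀ w : Circle, (w, -((κ * ε : ℝ) : ℂ) * (w : ℂ)⁻¹) ∈ S := by
    intro w
    have hw0 : (w : ℂ) ≠ 0 := Circle.coe_ne_zero w
    have hexp : u + (-((κ * ε : ℝ) : ℂ) * (w : ℂ)⁻¹) • (y + ((ε : ℂ) * w) • u) =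
        ((1 - κ * ε ^ 2 : ℝ) : ℂ) • u + (-((κ * ε : ℝ) : ℂ) * (w : ℂ)⁻¹) • y := by
      have : (-((κ * ε : ℝ) : ℂ) * (w : ℂ)⁻¹) * ((ε : ℂ) * w) = -((κ * ε ^ 2 : ℝ) : ℂ) := by
        push_cast
        field_simp
      rw [smul_add, smul_smul, this]
      push_cast
      module
    have hnorm : ‖u + (-((κ * ε : ℝ) : ℂ) * (w : ℂ)⁻¹) • (y + ((ε : ℂ) * w) • u)‖ < ρ := by
      rw [hexp]
      have hpy := norm_add_sq_eq_norm_sq_add_norm_sq_of_inner_eq_zero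
        (𝕜 := ℂ) (((1 - κ * ε ^ 2 : ℝ) : ℂ) • u) ((-((κ * ε : ℝ) : ℂ) * (w : ℂ)⁻¹) • y)
        (by rw [inner_smul_left, inner_smul_right, hy]; simp)
      have h1 : ‖((1 - κ * ε ^ 2 : ℝ) : ℂ) • u‖ * ‖((1 - κ * ε ^ 2 : ℝ) : ℂ) • u‖ =
          (1 - κ * ε ^ 2) ^ 2 * ρ ^ 2 := by
        rw [norm_smul, hu, Complex.norm_real, Real.norm_eq_abs, ← sq, mul_pow, sq_abs]
      have h2 : ‖(-((κ * ε : ℝ) : ℂ) * (w : ℂ)⁻¹) • y‖ * ‖(-((κ * ε : ℝ) : ℂ) * (w : ℂ)⁻¹) • y‖ =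
          (κ * ε) ^ 2 * ‖y‖ ^ 2 := by
        rw [norm_smul, norm_mul, norm_neg, norm_inv, Circle.norm_coe, inv_one, mul_one,
          Complex.norm_real, Real.norm_eq_abs, ← sq, mul_pow, sq_abs]
      rw [h1, h2] at hpy
      refine lt_of_pow_lt_pow_left₀ 2 hρ.le ?_
      rw [sq, hpy]
      have h3 : (1 - κ * ε ^ 2) ^ 2 * ρ ^ 2 + (κ * ε) ^ 2 * ‖y‖ ^ 2 =
          ρ ^ 2 - κ * ε ^ 2 * (2 * ρ ^ 2 - κ * (ρ ^ 2 * ε ^ 2 + ‖y‖ ^ 2)) := by ring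
      rw [h3, hκm]
      have : 0 < κ * ε ^ 2 * ρ ^ 2 := by positivity
      linarith
    have := hball _ hnorm
    simpa only [S, Set.mem_ofPred_eq, map_add, map_smul, add_assoc] using this
  have hF0 : ∀ p ∈ S, p.2 ≠ 0 := by
    intro p hpS h0
    simp only [S, Set.mem_ofPred_eq, h0, zero_smul, add_zero] at hpS
    exact hp hpS
  have hsc : ∀ w : Circle, IsSimplyConnected {t : ℂ | (w, t) ∈ S} := by
    intro w
    have hset : {t : ℂ | (w, t) ∈ S} =
        {t : ℂ | (z + T u) + t • T (y + ((ε : ℂ) * w) • u) ∈ D} := Set.ext fun t => Iff.rfl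
    rw [hset]
    refine hC.isSimplyConnected_slice ?_ ⟨1, haS w⟩
    rw [Ne, map_eq_zero_iff T T.injective]
    intro h0
    have h1 : inner ℂ y (y + ((ε : ℂ) * w) • u) = 0 := by rw [h0, inner_zero_right]
    rw [inner_add_right, inner_smul_right, inner_eq_zero_symm.1 hy, mul_zero, add_zero,
      inner_self_eq_zero] at h1
    exact hy0 h1
  obtain ⟨c, hc, hcF⟩ := exists_continuous_log_ratio hS hsc (F := Prod.snd)
    continuous_snd.continuousOn hF0 (a := fun _ => 1)
    (b := fun w => -((κ * ε : ℝ) : ℂ) * (w : ℂ)⁻¹) continuous_const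
    (continuous_const.mul (Continuous.inv₀ (by fun_prop) fun w => Circle.coe_ne_zero w)) haS hbS
  exact not_exists_continuous_log_circle (-((κ * ε : ℝ) : ℂ)) c hc fun w => by simpa using hcF w

end CConvex

/-! ### Univalent maps into the disc and Koebe's quarter theorem -/

/-- Holomorphic square roots exist wherever continuous logarithms do. -/
theorem HasContinuousLogs.exists_sqrt {G : Set ℂ} (hG : HasContinuousLogs G) (hGo : IsOpen G)
    {g : ℂ → ℂ} (hg : DifferentiableOn ℂ g G) (hg0 : ∀ w ∈ G, g w ≠ 0) :
    ∃ s : ℂ → ℂ, DifferentiableOn ℂ s G ∧ ∀ w ∈ G, s w ^ 2 = g w := by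
  obtain ⟨f, hf, hfg⟩ := hG g hg.continuousOn hg0
  have hsq : ∀ w ∈ G, Complex.exp (f w / 2) ^ 2 = g w := by
    intro w hw
    rw [← hfg w hw, ← Complex.exp_nat_mul]
    congr 1
    push_cast
    ring
  refine ⟨fun w => Complex.exp (f w / 2), fun w₀ hw₀ => ?_, hsq⟩
  set s : ℂ → ℂ := fun w => Complex.exp (f w / 2) with hs
  have hsc : ContinuousAt s w₀ := by
    have := hf.continuousAt (hGo.mem_nhds hw₀)
    fun_prop
  have hs0 : s w₀ ≠ 0 := Complex.exp_ne_zero _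
  have hd := (hg.differentiableAt (hGo.mem_nhds hw₀)).hasDerivAt
  have hsum : ContinuousAt (fun w => s w + s w₀) w₀ := by fun_prop
  have hne : s w₀ + s w₀ ≠ 0 := by
    rw [← two_mul]
    exact mul_ne_zero two_ne_zero hs0
  have : HasDerivAt s (deriv g w₀ / (s w₀ + s w₀)) w₀ := by
    -- The slope of `s` is the slope of `g = s ^ 2` divided by `s w + s w₀`, so continuity of `s`
    -- suffices.
    rw [hasDerivAt_iff_tendsto_slope] at hd ⊢
    refine (hd.div (hsum.tendsto.mono_left nhdsWithin_le_nhds) hne).congr' ?_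
    filter_upwards [nhdsWithin_le_nhds (hsum.eventually_ne hne),
      nhdsWithin_le_nhds (hGo.mem_nhds hw₀), self_mem_nhdsWithin] with w h1 h2 h3
    have h4 : w - w₀ ≠ 0 := sub_ne_zero.2 h3
    simp only [Pi.div_apply, slope_def_field]
    rw [← hsq w h2, ← hsq w₀ hw₀]
    field_simp
    ring
  exact this.differentiableAt.differentiableWithinAt

/-- The involutive automorphism of the unit disc exchanging `0` and `a`. -/
noncomputable def discInvolution (a w : ℂ) : ℂ := (a - w) / (1 - conj a * w)

theorem one_sub_conj_mul_ne_zero {a w : ℂ} (ha : ‖a‖ < 1) (hw : ‖w‖ < 1) :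
    1 - conj a * w ≠ 0 := by
  intro h
  have h1 : ‖conj a * w‖ = 1 := by rw [← sub_eq_zero.1 h, norm_one]
  rw [norm_mul, RCLike.norm_conj] at h1
  have : ‖a‖ * ‖w‖ < 1 := mul_lt_one_of_nonneg_of_lt_one_left (norm_nonneg _) ha hw.le
  linarith

theorem norm_discInvolution_lt_one {a w : ℂ} (ha : ‖a‖ < 1) (hw : ‖w‖ < 1) :
    ‖discInvolution a w‖ < 1 := by
  have h0 := one_sub_conj_mul_ne_zero ha hw
  rw [discInvolution, norm_div, div_lt_one (norm_pos_iff.2 h0)]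
  refine lt_of_pow_lt_pow_left₀ 2 (norm_nonneg _) ?_
  have h1 : ‖1 - conj a * w‖ ^ 2 - ‖a - w‖ ^ 2 = (1 - ‖a‖ ^ 2) * (1 - ‖w‖ ^ 2) := by
    simp only [← Complex.normSq_eq_norm_sq, Complex.normSq_apply]
    simp
    ring
  have h2 : 0 < (1 - ‖a‖ ^ 2) * (1 - ‖w‖ ^ 2) := by
    apply mul_pos <;> nlinarith [norm_nonneg a, norm_nonneg w]
  linarith

theorem discInvolution_discInvolution {a w : ℂ} (ha : ‖a‖ < 1) (hw : ‖w‖ < 1) :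
    discInvolution a (discInvolution a w) = w := by
  have h0 := one_sub_conj_mul_ne_zero ha hw
  have h1 := one_sub_conj_mul_ne_zero ha (norm_discInvolution_lt_one ha hw)
  have h2 : discInvolution a w * (1 - conj a * w) = a - w := div_mul_cancel₀ _ h0
  rw [discInvolution, div_eq_iff h1]
  linear_combination -h2

theorem hasDerivAt_discInvolution {a w : ℂ} (h : 1 - conj a * w ≠ 0) :
    HasDerivAt (discInvolution a) (-(1 - conj a * a) / (1 - conj a * w) ^ 2) w := by
  have h1 : HasDerivAt (fun w : ℂ => a - w) (-1) w := by
    simpa using (hasDerivAt_id w).const_sub a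
  have h2 : HasDerivAt (fun w : ℂ => 1 - conj a * w) (-conj a) w := by
    simpa using ((hasDerivAt_id w).const_mul (conj a)).const_sub 1
  convert! h1.div h2 h using 1
  ring

theorem discInvolution_self (a : ℂ) : discInvolution a a = 0 := by simp [discInvolution]

theorem discInvolution_zero (a : ℂ) : discInvolution a 0 = a := by simp [discInvolution]

/-- Univalent maps from `G` into the unit disc fixing the origin. -/
structure IsUnivalentIntoDisc (G : Set ℂ) (f : ℂ → ℂ) : Prop where
  differentiableOn : DifferentiableOn ℂ f G
  norm_lt_one : ∀ w ∈ G, ‖f w‖ < 1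
  injOn : Set.InjOn f G
  deriv_ne_zero : ∀ w ∈ G, deriv f w ≠ 0
  map_zero : f 0 = 0

/-- Koebe's square root transformation: a univalent map into the disc that omits the value `a` can
be replaced by one with a larger derivative at the origin. -/
theorem IsUnivalentIntoDisc.exists_of_omitted {G : Set ℂ} {f : ℂ → ℂ}
    (hf : IsUnivalentIntoDisc G f) (hG : HasContinuousLogs G) (hGo : IsOpen G) (h0 : (0 : ℂ) ∈ G)
    {a : ℂ} (ha : ‖a‖ < 1) (haf : ∀ w ∈ G, f w ≠ a) :
    ∃ k, IsUnivalentIntoDisc G k ∧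
      ‖deriv f 0‖ * (1 + ‖a‖) = ‖deriv k 0‖ * (2 * √‖a‖) := by
  have hφd : ∀ b : ℂ, ‖b‖ < 1 → DifferentiableOn ℂ (discInvolution b) (Metric.ball 0 1) :=
    fun b hb w hw => (hasDerivAt_discInvolution (one_sub_conj_mul_ne_zero hb
      (by simpa using hw))).differentiableAt.differentiableWithinAt
  obtain ⟨h, hhd, hsq⟩ := hG.exists_sqrt hGo (g := fun w => discInvolution a (f w))
    ((hφd a ha).comp hf.differentiableOn fun w hw => by simpa using hf.norm_lt_one w hw)
    (fun w hw => div_ne_zero (sub_ne_zero.2 (haf w hw).symm)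
      (one_sub_conj_mul_ne_zero ha (hf.norm_lt_one w hw)))
  have hh1 : ∀ w ∈ G, ‖h w‖ < 1 := by
    intro w hw
    have := norm_discInvolution_lt_one ha (hf.norm_lt_one w hw)
    rw [← hsq w hw, norm_pow] at this
    exact (pow_lt_one_iff_of_nonneg (norm_nonneg _) two_ne_zero).1 this
  set b := h 0 with hb
  have hb1 : ‖b‖ < 1 := hh1 0 h0
  have hba : b ^ 2 = a := by rw [hb, hsq 0 h0, hf.map_zero, discInvolution_zero]
  have hbn : ‖b‖ ^ 2 = ‖a‖ := by rw [← hba, norm_pow]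
  let k : ℂ → ℂ := fun w => discInvolution b (h w)
  -- The two-to-one self-map of the disc that undoes the transformation: `f = B ∘ k`. The gain in
  -- derivative is `1 / |B'(0)|`, with `|B'(0)| = 2 √|a| / (1 + |a|)`.
  let B : ℂ → ℂ := fun w => discInvolution a (discInvolution b w ^ 2)
  have hkd : DifferentiableOn ℂ k G :=
    (hφd b hb1).comp hhd fun w hw => by simpa using hh1 w hw
  have hk1 : ∀ w ∈ G, ‖k w‖ < 1 := fun w hw => norm_discInvolution_lt_one hb1 (hh1 w hw)
  have hsq1 : ∀ w : ℂ, ‖w‖ < 1 → ‖w ^ 2‖ < 1 := fun w hw => by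
    rw [norm_pow]
    exact pow_lt_one₀ (norm_nonneg _) hw two_ne_zero
  have hBd : ∀ w : ℂ, ‖w‖ < 1 → DifferentiableAt ℂ B w := by
    intro w hw
    have h1 := hasDerivAt_discInvolution (one_sub_conj_mul_ne_zero hb1 hw)
    have h2 := hasDerivAt_discInvolution (one_sub_conj_mul_ne_zero ha
      (hsq1 _ (norm_discInvolution_lt_one hb1 hw)))
    exact (h2.comp w (h1.fun_pow 2)).differentiableAt
  have hBk : ∀ w ∈ G, B (k w) = f w := by
    intro w hw
    simp only [B, k]
    rw [discInvolution_discInvolution hb1 (hh1 w hw), hsq w hw,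
      discInvolution_discInvolution ha (hf.norm_lt_one w hw)]
  have hderiv : ∀ w ∈ G, deriv f w = deriv B (k w) * deriv k w := by
    intro w hw
    have h1 := (hBd _ (hk1 w hw)).hasDerivAt.comp w (hkd.differentiableAt (hGo.mem_nhds hw)).hasDerivAt
    have h2 : f =ᶠ[𝓝 w] B ∘ k := by
      filter_upwards [hGo.mem_nhds hw] with v hv
      exact (hBk v hv).symm
    rw [h2.deriv_eq, h1.deriv]
  have hk0 : k 0 = 0 := discInvolution_self b
  have hB0 : ‖deriv B 0‖ * (1 + ‖a‖) = 2 * √‖a‖ := by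
    have h1 := hasDerivAt_discInvolution (a := b) (w := 0) (by simp)
    have hsqb : discInvolution b 0 ^ 2 = a := by rw [discInvolution_zero, hba]
    have h2 : HasDerivAt (discInvolution a) (-(1 - conj a * a) / (1 - conj a * a) ^ 2)
        (discInvolution b 0 ^ 2) := by
      rw [hsqb]
      exact hasDerivAt_discInvolution (one_sub_conj_mul_ne_zero ha ha)
    have h3 := (h2.comp (0 : ℂ) (h1.fun_pow 2)).deriv
    have hca : conj a * a = ((‖b‖ ^ 4 : ℝ) : ℂ) := by
      rw [Complex.conj_mul', ← hbn]
      push_cast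
      ring
    have hcb : conj b * b = ((‖b‖ ^ 2 : ℝ) : ℂ) := by
      rw [Complex.conj_mul']
      push_cast
      ring
    have hb4 : (1 : ℝ) - ‖b‖ ^ 4 ≠ 0 := by
      have := pow_lt_one₀ (norm_nonneg b) hb1 (n := 4) (by norm_num)
      linarith
    have h4 : deriv B 0 * ((1 + ‖b‖ ^ 2 : ℝ) : ℂ) = 2 * b := by
      have h5 : deriv B 0 = _ := h3
      rw [h5, discInvolution_zero, hca, hcb]
      have hb4' : (1 : ℂ) - (‖b‖ : ℂ) ^ 4 ≠ 0 := by exact_mod_cast hb4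
      push_cast
      field_simp
      ring
    have h6 := congrArg norm h4
    rw [norm_mul, norm_mul, Complex.norm_real, Real.norm_eq_abs,
      abs_of_pos (by positivity), Complex.norm_ofNat] at h6
    rw [← hbn, Real.sqrt_sq (norm_nonneg _), h6]
  refine ⟨k, ⟨hkd, hk1, fun w hw v hv hwv => ?_, fun w hw hkw => ?_, hk0⟩, ?_⟩
  · exact hf.injOn hw hv (by rw [← hBk w hw, ← hBk v hv, hwv])
  · exact hf.deriv_ne_zero w hw (by rw [hderiv w hw, hkw, mul_zero])
  · rw [hderiv 0 h0, hk0, norm_mul, ← hB0]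
    ring

/-- The branch of `√(1 - w)` on a set omitting `1`. -/
theorem HasContinuousLogs.exists_sqrt_one_sub {G : Set ℂ} (hG : HasContinuousLogs G)
    (hGo : IsOpen G) (h0 : (0 : ℂ) ∈ G) (h1 : (1 : ℂ) ∉ G) :
    ∃ s : ℂ → ℂ, DifferentiableOn ℂ s G ∧ s 0 ^ 2 = 1 ∧ (∀ w ∈ G, 2 * s w * deriv s w = -1) ∧
      ∀ w ∈ G, ∀ v ∈ G, s w + s v ≠ 0 ∧ (s w = s v → w = v) := by
  obtain ⟨s, hsd, hsq⟩ := hG.exists_sqrt hGo (g := fun w => 1 - w) (by fun_prop)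
    (fun w hw h => h1 (by rwa [← sub_eq_zero.1 h] at hw))
  have hinj : ∀ w ∈ G, ∀ v ∈ G, s w ^ 2 = s v ^ 2 → w = v := by
    intro w hw v hv h
    rw [hsq w hw, hsq v hv] at h
    linear_combination -h
  refine ⟨s, hsd, by simpa using hsq 0 h0, fun w hw => ?_, fun w hw v hv => ⟨fun h => ?_, fun h => ?_⟩⟩
  · have h2 := ((hsd.differentiableAt (hGo.mem_nhds hw)).hasDerivAt.fun_pow 2).deriv
    have h3 : (fun w => s w ^ 2) =ᶠ[𝓝 w] fun w => 1 - w := by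
      filter_upwards [hGo.mem_nhds hw] with v hv using hsq v hv
    rw [h3.deriv_eq, deriv_const_sub, deriv_id''] at h2
    rw [h2]
    norm_num
  · have hwv := hinj w hw v hv (by rw [eq_neg_of_add_eq_zero_left h, neg_sq])
    subst hwv
    have hs0 : s w = 0 := by linear_combination h / 2
    have := hsq w hw
    rw [hs0] at this
    exact h1 (by rwa [show (1 : ℂ) = w by linear_combination -this])
  · exact hinj w hw v hv (by rw [h])

/-- The image of the branch `s` of `√(1 - w)` is disjoint from its negative. As it contains a disc
about `s 0`, it avoids one about `-s 0`, so `1 / (s + s 0)` is bounded and univalent. -/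
theorem HasContinuousLogs.exists_isUnivalentIntoDisc {G : Set ℂ} (hG : HasContinuousLogs G)
    (hGo : IsOpen G) (h0 : (0 : ℂ) ∈ G) (h1 : (1 : ℂ) ∉ G) : ∃ f, IsUnivalentIntoDisc G f := by
  obtain ⟨s, hsd, -, hs', hs⟩ := hG.exists_sqrt_one_sub hGo h0 h1
  have hsn : ∀ w ∈ G, deriv s w ≠ 0 := fun w hw h => by
    have := hs' w hw
    simp [h] at this
  have himg : s '' G ∈ 𝓝 (s 0) := by
    rw [← (hsd.analyticAt (hGo.mem_nhds h0)).hasStrictDerivAt.map_nhds_eq (hsn 0 h0)]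
    exact image_mem_map (hGo.mem_nhds h0)
  obtain ⟨ε, hε, hball⟩ := Metric.mem_nhds_iff.1 himg
  have hfar : ∀ w ∈ G, ε ≤ ‖s w + s 0‖ := by
    intro w hw
    by_contra! hlt
    obtain ⟨v, hv, hvw⟩ := hball (show -s w ∈ Metric.ball (s 0) ε by
      rw [mem_ball_iff_norm, ← norm_neg]
      convert! hlt using 2
      ring)
    exact (hs w hw v hv).1 (by rw [hvw]; ring)
  have hne : ∀ w ∈ G, s w + s 0 ≠ 0 := fun w hw => (hs w hw 0 h0).1
  have hder : ∀ w ∈ G, HasDerivAt (fun w => ((ε / 3 : ℝ) : ℂ) * ((s w + s 0)⁻¹ - (s 0 + s 0)⁻¹))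
      (((ε / 3 : ℝ) : ℂ) * (-deriv s w / (s w + s 0) ^ 2)) w := fun w hw =>
    ((((hsd.differentiableAt (hGo.mem_nhds hw)).hasDerivAt.add_const (s 0)).fun_inv
      (hne w hw)).sub_const _).const_mul _
  have hε3 : ((ε / 3 : ℝ) : ℂ) ≠ 0 := by exact_mod_cast (by positivity : ε / 3 ≠ 0)
  have hinv : ∀ w ∈ G, ‖(s w + s 0)⁻¹‖ ≤ ε⁻¹ := fun w hw => by
    rw [norm_inv]
    exact inv_anti₀ hε (hfar w hw)
  refine ⟨fun w => ((ε / 3 : ℝ) : ℂ) * ((s w + s 0)⁻¹ - (s 0 + s 0)⁻¹),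
    fun w hw => (hder w hw).differentiableAt.differentiableWithinAt, fun w hw => ?_,
    fun w hw v hv h => ?_, fun w hw => ?_, by simp⟩
  · rw [norm_mul, Complex.norm_real, Real.norm_eq_abs, abs_of_pos (by positivity)]
    have h2 : ‖(s w + s 0)⁻¹ - (s 0 + s 0)⁻¹‖ ≤ ε⁻¹ + ε⁻¹ :=
      (norm_sub_le _ _).trans (add_le_add (hinv w hw) (hinv 0 h0))
    calc ε / 3 * ‖(s w + s 0)⁻¹ - (s 0 + s 0)⁻¹‖ ≤ ε / 3 * (ε⁻¹ + ε⁻¹) := by gcongr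
      _ = 2 / 3 := by field_simp; norm_num
      _ < 1 := by norm_num
  · have h2 := mul_left_cancel₀ hε3 h
    have h3 := inv_injective (sub_left_injective h2)
    exact (hs w hw v hv).2 (add_right_cancel h3)
  · rw [(hder w hw).deriv]
    exact mul_ne_zero hε3 (div_ne_zero (neg_ne_zero.2 (hsn w hw)) (pow_ne_zero 2 (hne w hw)))

/-- The inverse of a univalent map is holomorphic. -/
theorem IsUnivalentIntoDisc.hasDerivAt_inverse {G : Set ℂ} {f : ℂ → ℂ}
    (hf : IsUnivalentIntoDisc G f) (hGo : IsOpen G) {V : Set ℂ} (hV : IsOpen V) {g : ℂ → ℂ}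
    (hg : ∀ u ∈ V, g u ∈ G ∧ f (g u) = u) {u : ℂ} (hu : u ∈ V) :
    HasDerivAt g (deriv f (g u))⁻¹ u := by
  obtain ⟨hgu, hfu⟩ := hg u hu
  have hst := (hf.differentiableOn.analyticAt (hGo.mem_nhds hgu)).hasStrictDerivAt
  refine HasDerivAt.of_local_left_inverse ?_ hst.hasDerivAt (hf.deriv_ne_zero _ hgu) ?_
  -- Continuity of `g`: `f` maps neighbourhoods of `g u` onto neighbourhoods of `u`, and injectivity
  -- identifies the preimages with values of `g`.
  · intro W hW
    have h1 : f '' (W ∩ G) ∈ 𝓝 u := by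
      have := image_mem_map (m := f) (inter_mem hW (hGo.mem_nhds hgu))
      rwa [hst.map_nhds_eq (hf.deriv_ne_zero _ hgu), hfu] at this
    rw [mem_map]
    filter_upwards [h1, hV.mem_nhds hu] with v hv hvV
    obtain ⟨w, ⟨hwW, hwG⟩, rfl⟩ := hv
    have := hf.injOn (hg _ hvV).1 hwG (hg _ hvV).2
    rwa [Set.mem_preimage, this]
  · filter_upwards [hV.mem_nhds hu] with v hv using (hg v hv).2

/-- A univalent map of `G ∌ 1` onto a set containing the disc of radius `r` has derivative at least
`r / 4` at the origin. -/
theorem IsUnivalentIntoDisc.le_norm_deriv {G : Set ℂ} {f : ℂ → ℂ}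
    (hf : IsUnivalentIntoDisc G f) (hG : HasContinuousLogs G) (hGo : IsOpen G) (h0 : (0 : ℂ) ∈ G)
    (h1 : (1 : ℂ) ∉ G) {r t : ℝ} (ht : 0 < t) (htr : t < r)
    (hsurj : Metric.ball 0 r ⊆ f '' G) : t / 4 ≤ ‖deriv f 0‖ := by
  obtain ⟨s, hsd, hs0, hs', hs⟩ := hG.exists_sqrt_one_sub hGo h0 h1
  choose! g hgG hgf using fun u (hu : u ∈ Metric.ball (0 : ℂ) r) => hsurj hu
  have hr : 0 < r := ht.trans htr
  have hs00 : s 0 ≠ 0 := fun h => by simp [h] at hs0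
  have hg0 : g 0 = 0 := hf.injOn (hgG 0 (by simpa using hr)) h0
    (by rw [hgf 0 (by simpa using hr), hf.map_zero])
  have hgd : ∀ u ∈ Metric.ball (0 : ℂ) r, HasDerivAt g (deriv f (g u))⁻¹ u := fun u hu =>
    hf.hasDerivAt_inverse hGo Metric.isOpen_ball (fun v hv => ⟨hgG v hv, hgf v hv⟩) hu
  have hmem : ∀ ζ ∈ Metric.ball (0 : ℂ) (r / t), (t : ℂ) * ζ ∈ Metric.ball (0 : ℂ) r := by
    intro ζ hζ
    rw [mem_ball_zero_iff, lt_div_iff₀ ht] at hζ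
    rw [mem_ball_zero_iff, norm_mul, Complex.norm_real, Real.norm_eq_abs, abs_of_pos ht]
    linarith
  have hder : ∀ ζ ∈ Metric.ball (0 : ℂ) (r / t), HasDerivAt (fun ζ => s (g (t * ζ)) / s 0)
      (deriv s (g (t * ζ)) * ((deriv f (g (t * ζ)))⁻¹ * t) / s 0) ζ := by
    intro ζ hζ
    have ha : HasDerivAt (fun ζ : ℂ => (t : ℂ) * ζ) t ζ := by
      simpa using (hasDerivAt_id ζ).const_mul (t : ℂ)
    have hb := (hgd _ (hmem ζ hζ)).comp ζ ha
    have hc := (hsd.differentiableAt (hGo.mem_nhds (hgG _ (hmem ζ hζ)))).hasDerivAt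
    exact (hc.comp ζ hb).div_const _
  -- The values of `√(1 - w)` along the inverse of `f`, normalised to be `1` at the origin, never
  -- add up to `0`. The derivative there has modulus `t / (2 |f'(0)|)`, and the bound `2` gives
  -- Koebe's constant.
  have hkey := norm_deriv_le_two_of_add_ne_zero (R := r / t) ((one_lt_div ht).2 htr)
    (F := fun ζ => s (g (t * ζ)) / s 0)
    (fun ζ hζ => (hder ζ hζ).differentiableAt.differentiableWithinAt)
    (by simp [hg0, hs00])
    (fun ζ hζ ξ hξ => by
      rw [← add_div]
      exact div_ne_zero (hs _ (hgG _ (hmem ζ hζ)) _ (hgG _ (hmem ξ hξ))).1 hs00)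
  rw [(hder 0 (by simpa using div_pos hr ht)).deriv, mul_zero, hg0] at hkey
  have hn0 : ‖s 0‖ = 1 := by
    have := congrArg norm hs0
    rw [norm_pow, norm_one] at this
    exact (pow_eq_one_iff_of_nonneg (norm_nonneg _) two_ne_zero).1 this
  have hn1 : ‖deriv s 0‖ = 1 / 2 := by
    have := congrArg norm (hs' 0 h0)
    rw [norm_mul, norm_mul, hn0, norm_neg, norm_one, Complex.norm_ofNat] at this
    linarith
  rw [norm_div, norm_mul, norm_mul, norm_inv, hn0, hn1, Complex.norm_real, Real.norm_eq_abs,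
    abs_of_pos ht] at hkey
  have hfp : 0 < ‖deriv f 0‖ := norm_pos_iff.2 (hf.deriv_ne_zero 0 h0)
  have h5 : 1 / 2 * (‖deriv f 0‖⁻¹ * t) / 1 = t / (2 * ‖deriv f 0‖) := by
    field_simp
  rw [h5, div_le_iff₀ (by positivity)] at hkey
  linarith

/-- Koebe's quarter theorem, in the form of a lower bound for the analytic capacity. -/
theorem HasContinuousLogs.exists_deriv_ge {G : Set ℂ} (hG : HasContinuousLogs G) (hGo : IsOpen G)
    (h0 : (0 : ℂ) ∈ G) (h1 : (1 : ℂ) ∉ G) {c : ℝ} (hc : c < 1 / 4) :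
    ∃ f, IsUnivalentIntoDisc G f ∧ c ≤ ‖deriv f 0‖ := by
  obtain ⟨f₀, hf₀⟩ := hG.exists_isUnivalentIntoDisc hGo h0 h1
  obtain ⟨δ, hδ, hball⟩ := Metric.mem_nhds_iff.1 (hGo.mem_nhds h0)
  let A : Set ℝ := {x | ∃ f, IsUnivalentIntoDisc G f ∧ x = ‖deriv f 0‖}
  have hbdd : BddAbove A := by
    refine ⟨1 / δ, ?_⟩
    rintro _ ⟨f, hf, rfl⟩
    refine Complex.norm_deriv_le_div_of_mapsTo_ball (hf.differentiableOn.mono hball) ?_ hδ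
    intro w hw
    rw [hf.map_zero, mem_closedBall_zero_iff]
    exact (hf.norm_lt_one w (hball hw)).le
  have hmem₀ : ‖deriv f₀ 0‖ ∈ A := ⟨f₀, hf₀, rfl⟩
  have hpos : 0 < sSup A :=
    (norm_pos_iff.2 (hf₀.deriv_ne_zero 0 h0)).trans_le (le_csSup hbdd hmem₀)
  obtain ⟨t, htc, ht0, ht1⟩ : ∃ t : ℝ, c ≤ t / 4 ∧ 0 < t ∧ t < 1 := by
    refine ⟨max (1 / 2) (4 * c), ?_, by positivity, max_lt (by norm_num) (by linarith)⟩
    linarith [le_max_right (1 / 2) (4 * c)]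
  obtain ⟨β, hβ0, hβ1, htβ⟩ : ∃ β : ℝ, 0 < β ∧ β < 1 ∧ t < β ^ 2 := by
    refine ⟨√((1 + t) / 2), Real.sqrt_pos.2 (by linarith), ?_, ?_⟩
    · rw [Real.sqrt_lt' one_pos]
      linarith
    · rw [Real.sq_sqrt (by linarith)]
      linarith
  have hθ : 2 * β / (1 + β ^ 2) < 1 := by
    rw [div_lt_one (by positivity)]
    nlinarith [sq_pos_of_pos (sub_pos.2 hβ1)]
  -- No extremal map is needed. If an `f` within the factor `2β / (1 + β ^ 2)` of the supremum
  -- omitted some `|a| < β ^ 2`, the square root transformation would exceed the supremum, as `2α /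
  -- (1 + α ^ 2)` increases on `[0, 1]`.
  obtain ⟨x, ⟨f, hf, rfl⟩, hlt⟩ := exists_lt_of_lt_csSup ⟨_, hmem₀⟩
    (show 2 * β / (1 + β ^ 2) * sSup A < sSup A by nlinarith)
  refine ⟨f, hf, htc.trans (hf.le_norm_deriv hG hGo h0 h1 ht0 htβ ?_)⟩
  intro a ha
  by_contra hna
  rw [mem_ball_zero_iff] at ha
  have hβ2 : β ^ 2 < 1 := pow_lt_one₀ hβ0.le hβ1 two_ne_zero
  obtain ⟨k, hk, hkf⟩ := hf.exists_of_omitted hG hGo h0 (ha.trans hβ2)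
    (fun w hw h => hna ⟨w, hw, h⟩)
  have hkle : ‖deriv k 0‖ ≤ sSup A := le_csSup hbdd ⟨k, hk, rfl⟩
  set α := √‖a‖ with hα
  have hα2 : α ^ 2 = ‖a‖ := Real.sq_sqrt (norm_nonneg _)
  have hα0 : 0 ≤ α := Real.sqrt_nonneg _
  have hαβ : α < β := by
    rw [hα, Real.sqrt_lt' hβ0]
    exact ha
  rw [← hα2] at hkf
  rw [div_mul_eq_mul_div, div_lt_iff₀ (by positivity)] at hlt
  have h2 : ‖deriv f 0‖ * (1 + α ^ 2) ≤ sSup A * (2 * α) := by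
    rw [hkf]
    exact mul_le_mul_of_nonneg_right hkle (by positivity)
  have h3 : α * (1 + β ^ 2) ≤ β * (1 + α ^ 2) := by
    have : 0 ≤ (β - α) * (1 - α * β) := by
      apply mul_nonneg <;> nlinarith
    nlinarith
  have h4 : ‖deriv f 0‖ * (1 + α ^ 2) * (1 + β ^ 2) ≤ sSup A * 2 * (β * (1 + α ^ 2)) := by
    calc _ ≤ sSup A * (2 * α) * (1 + β ^ 2) := by gcongr
      _ = sSup A * 2 * (α * (1 + β ^ 2)) := by ring
      _ ≤ _ := by gcongr
  have h5 := mul_lt_mul_of_pos_right hlt (show 0 < 1 + α ^ 2 by positivity)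
  nlinarith

/-! ### Omitted functionals and inscribed ellipsoids -/

section Functionals

variable {n : ℕ} {D : Set (Cn n)}

/-- Functionals `l` whose affine hyperplane `l (w - z) = 1` misses `D`. -/
def omittedFunctionals (D : Set (Cn n)) (z : Cn n) : Set (Cn n →L[ℂ] ℂ) :=
  {l | ∀ w ∈ D, l (w - z) ≠ 1}

/-- If `|l v| > ‖v‖ / δ`, then `z + v / l v` is a point of the ball on the hyperplane `l (w - z) =
1`. -/
theorem norm_le_of_mem_omittedFunctionals {z : Cn n} {δ : ℝ} (hδ : 0 < δ)
    (hball : Metric.ball z δ ⊆ D) {l : Cn n →L[ℂ] ℂ} (hl : l ∈ omittedFunctionals D z) :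
    ‖l‖ ≤ δ⁻¹ := by
  refine l.opNorm_le_bound (by positivity) fun v => ?_
  by_contra! h
  rw [inv_mul_lt_iff₀ hδ] at h
  have hlv : l v ≠ 0 := by
    intro h0
    rw [h0, norm_zero, mul_zero] at h
    exact absurd h (not_lt.2 (norm_nonneg _))
  refine hl (z + (l v)⁻¹ • v) (hball ?_) (by simp [hlv])
  rw [mem_ball_iff_norm, add_sub_cancel_left, norm_smul, norm_inv,
    inv_mul_lt_iff₀ (norm_pos_iff.2 hlv)]
  linarith

theorem isCompact_omittedFunctionals (hD : IsOpen D) {z : Cn n} (hz : z ∈ D) :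
    IsCompact (omittedFunctionals D z) := by
  have : ProperSpace (Cn n →L[ℂ] ℂ) := FiniteDimensional.proper ℂ _
  obtain ⟨δ, hδ, hball⟩ := Metric.mem_nhds_iff.1 (hD.mem_nhds hz)
  refine Metric.isCompact_of_isClosed_isBounded ?_ ?_
  · rw [← isOpen_compl_iff, isOpen_iff_mem_nhds]
    intro l₀ hl₀
    obtain ⟨w₀, hw₀, h1⟩ : ∃ w ∈ D, l₀ (w - z) = 1 := by
      simpa [omittedFunctionals] using hl₀
    have hev : ContinuousAt (fun l : Cn n →L[ℂ] ℂ => l (w₀ - z)) l₀ := by fun_prop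
    have hne : l₀ (w₀ - z) ≠ 0 := by rw [h1]; exact one_ne_zero
    -- For the complement to be open: when `l` is near `l₀`, rescaling `w₀ - z` so that `l` equals
    -- `1` on it moves the point only slightly, hence within `D`.
    have hcont : ContinuousAt (fun l : Cn n →L[ℂ] ℂ => z + (l (w₀ - z))⁻¹ • (w₀ - z)) l₀ :=
      continuousAt_const.add ((hev.inv₀ hne).smul continuousAt_const)
    have hmem : z + (l₀ (w₀ - z))⁻¹ • (w₀ - z) ∈ D := by simpa [h1] using hw₀
    filter_upwards [hcont.eventually (hD.mem_nhds hmem), hev.eventually_ne hne] with l h2 h3 hl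
    exact hl _ h2 (by rw [add_sub_cancel_left, map_smul, smul_eq_mul, inv_mul_cancel₀ h3])
  · refine (Metric.isBounded_closedBall (x := (0 : Cn n →L[ℂ] ℂ)) (r := δ⁻¹)).subset fun l hl => ?_
    rw [mem_closedBall_zero_iff]
    exact norm_le_of_mem_omittedFunctionals hδ hball hl

/-- An ellipsoid around `z` that no omitted hyperplane meets is contained in `D`. -/
theorem IsCConvex.ellipsoid_subset (hC : IsCConvex D) (hD : IsOpen D) {z : Cn n} (hz : z ∈ D)
    (T : Cn n ≃L[ℂ] Cn n) (hT : ∀ l ∈ omittedFunctionals D z, ∀ w, ‖l (T w)‖ ≤ ‖w‖) {w : Cn n}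
    (hw : ‖w‖ < 1) : z + T w ∈ D := by
  by_contra hwD
  have hK : IsCompact (Metric.closedBall (0 : Cn n) ‖w‖ ∩ {v | z + T v ∉ D}) :=
    (isCompact_closedBall _ _).inter_right
      ((hD.preimage (by fun_prop : Continuous fun v => z + T v)).isClosed_compl)
  obtain ⟨u, ⟨huw, huD⟩, hmin⟩ := hK.exists_isMinOn ⟨w, by simp, hwD⟩ continuous_norm.continuousOn
  have huw' : ‖u‖ ≤ ‖w‖ := by simpa using huw
  have hu0 : u ≠ 0 := by
    rintro rfl
    exact huD (by simpa using hz)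
  have hρ : 0 < ‖u‖ := norm_pos_iff.2 hu0
  have hball : ∀ v, ‖v‖ < ‖u‖ → z + T v ∈ D := by
    intro v hv
    by_contra hvD
    have := hmin (show v ∈ _ from ⟨by simpa using hv.le.trans huw', hvD⟩)
    exact absurd hv (not_lt.2 this)
  -- The complex tangent hyperplane at the nearest contact point `u`. It is omitted, yet `l (T u) =
  -- 1` while `‖u‖ < 1`, contradicting `hT`.
  let l : Cn n →L[ℂ] ℂ :=
    (((‖u‖ ^ 2 : ℝ) : ℂ)⁻¹ • innerSL ℂ u).comp (T.symm : Cn n →L[ℂ] Cn n)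
  have hn : ((‖u‖ ^ 2 : ℝ) : ℂ) ≠ 0 := by
    exact_mod_cast (by positivity : ‖u‖ ^ 2 ≠ 0)
  have hinner : inner ℂ u u = ((‖u‖ ^ 2 : ℝ) : ℂ) := by
    rw [inner_self_eq_norm_sq_to_K]
    push_cast
    rfl
  have hl : l ∈ omittedFunctionals D z := by
    intro v hv h1
    have h2 : inner ℂ u (T.symm (v - z)) = ((‖u‖ ^ 2 : ℝ) : ℂ) := by
      have h3 : ((‖u‖ ^ 2 : ℝ) : ℂ)⁻¹ * inner ℂ u (T.symm (v - z)) = 1 := h1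
      rw [inv_mul_eq_one₀ hn] at h3
      exact h3.symm
    have := hC.notMem_of_tangent hD T hρ hball rfl huD (y := T.symm (v - z) - u)
      (by rw [inner_sub_right, h2, hinner, sub_self])
    rw [add_sub_cancel, T.apply_symm_apply, add_sub_cancel] at this
    exact this hv
  have h4 : l (T u) = 1 := by
    have : l (T u) = ((‖u‖ ^ 2 : ℝ) : ℂ)⁻¹ * inner ℂ u (T.symm (T u)) := rfl
    rw [this, T.symm_apply_apply, hinner, inv_mul_cancel₀ hn]
  have := hT l hl u
  rw [h4, norm_one] at this
  linarith

/-- The linear map stretching the direction of the unit vector `v`. -/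
theorem exists_stretch {v : Cn n} (hv : ‖v‖ = 1) {δ R : ℝ} (hδ : 0 < δ) (hR : 0 < R) :
    ∃ T : Cn n ≃L[ℂ] Cn n, ∀ w,
      T w = (δ : ℂ) • w + (((R : ℂ) - δ) * inner ℂ v w) • v := by
  have hδ' : (δ : ℂ) ≠ 0 := by exact_mod_cast hδ.ne'
  have hR' : (R : ℂ) ≠ 0 := by exact_mod_cast hR.ne'
  have hvv : inner ℂ v v = (1 : ℂ) := by
    rw [inner_self_eq_norm_sq_to_K, hv]
    simp
  let S : ℂ → ℂ → Cn n →L[ℂ] Cn n := fun a b =>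
    a • ContinuousLinearMap.id ℂ (Cn n) + (b - a) • (innerSL ℂ v).smulRight v
  have hS : ∀ a b w, S a b w = a • w + ((b - a) * inner ℂ v w) • v := by
    intro a b w
    simp [S, smul_smul]
  have hinv : ∀ a b c d : ℂ, a * c = 1 → b * d = 1 → ∀ w, S a b (S c d w) = w := by
    intro a b c d h1 h2 w
    rw [hS, hS, inner_add_right, inner_smul_right, inner_smul_right, hvv, smul_add, smul_smul,
      smul_smul, h1, one_smul, add_assoc, ← add_smul]
    have : a * ((d - c) * inner ℂ v w) + (b - a) * (c * inner ℂ v w + (d - c) * inner ℂ v w * 1)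
        = (b * d - a * c) * inner ℂ v w := by ring
    rw [this, h1, h2]
    simp
  refine ⟨ContinuousLinearEquiv.equivOfInverse (S δ R) (S (δ : ℂ)⁻¹ (R : ℂ)⁻¹)
    (hinv _ _ _ _ (inv_mul_cancel₀ hδ') (inv_mul_cancel₀ hR'))
    (hinv _ _ _ _ (mul_inv_cancel₀ hδ') (mul_inv_cancel₀ hR')), fun w => hS _ _ w⟩

/-- The omitted functionals of a non-degenerate `ℂ`-convex set separate points. -/
theorem IsCConvex.exists_omittedFunctional_ne_zero (hC : IsCConvex D) (hD : IsOpen D)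
    (hnd : IsNondegenerate D) {z : Cn n} (hz : z ∈ D) {v : Cn n} (hv : v ≠ 0) :
    ∃ l ∈ omittedFunctionals D z, l v ≠ 0 := by
  wlog hv1 : ‖v‖ = 1 generalizing v
  · have hn : ((‖v‖ : ℝ) : ℂ)⁻¹ ≠ 0 := inv_ne_zero (by exact_mod_cast norm_ne_zero_iff.2 hv)
    obtain ⟨l, hl, hlv⟩ := this (v := ((‖v‖ : ℝ) : ℂ)⁻¹ • v) (smul_ne_zero hn hv)
      (by rw [norm_smul, norm_inv, Complex.norm_real, norm_norm,
            inv_mul_cancel₀ (norm_ne_zero_iff.2 hv)])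
    refine ⟨l, hl, fun h => hlv ?_⟩
    rw [map_smul, h, smul_zero]
  by_contra! hcon
  obtain ⟨δ, hδ, hball⟩ := Metric.mem_nhds_iff.1 (hD.mem_nhds hz)
  refine hnd (AffineSubspace.mk' z (ℂ ∙ v)) ?_ ?_
  · rw [IsComplexLine, AffineSubspace.direction_mk', finrank_span_singleton hv]
  · intro x hx
    rw [SetLike.mem_coe, AffineSubspace.mem_mk', Submodule.mem_span_singleton] at hx
    obtain ⟨t, ht⟩ := hx
    rw [vsub_eq_sub] at ht
    have hR : 0 < ‖t‖ + 1 := by positivity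
    have hR' : ((‖t‖ + 1 : ℝ) : ℂ) ≠ 0 := by exact_mod_cast hR.ne'
    obtain ⟨T, hT⟩ := exists_stretch hv1 hδ hR
    have hvv : inner ℂ v v = (1 : ℂ) := by
      rw [inner_self_eq_norm_sq_to_K, hv1]
      simp
    -- Omitted functionals all kill `v`, so stretching the ball of radius `δ` along `v` to any
    -- length `R` keeps the ellipsoid admissible. With `R = ‖t‖ + 1` it reaches `z + t • v`.
    have hmem := hC.ellipsoid_subset hD hz T (fun l hl w => ?_)
      (w := (t / ((‖t‖ + 1 : ℝ) : ℂ)) • v) ?_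
    · have hTv : T ((t / ((‖t‖ + 1 : ℝ) : ℂ)) • v) = t • v := by
        rw [hT, inner_smul_right, hvv, smul_smul, ← add_smul]
        congr 1
        field_simp
        ring
      rwa [hTv, ht, add_sub_cancel] at hmem
    · rw [hT, map_add, map_smul, map_smul, hcon l hl, smul_zero, add_zero, norm_smul,
        Complex.norm_real, Real.norm_eq_abs, abs_of_pos hδ]
      have h1 : ‖l w‖ ≤ δ⁻¹ * ‖w‖ :=
        l.le_of_opNorm_le (norm_le_of_mem_omittedFunctionals hδ hball hl) w
      calc δ * ‖l w‖ ≤ δ * (δ⁻¹ * ‖w‖) := by gcongr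
        _ = ‖w‖ := by rw [← mul_assoc, mul_inv_cancel₀ hδ.ne', one_mul]
    · rw [norm_smul, hv1, mul_one, norm_div, Complex.norm_real, Real.norm_eq_abs, abs_of_pos hR,
        div_lt_one hR]
      linarith

/-! ### Determinants of functionals and Auerbach's lemma -/

/-- The matrix of a tuple of functionals in the standard basis. -/
noncomputable def functionalMatrix (L : Fin n → Cn n →L[ℂ] ℂ) : Matrix (Fin n) (Fin n) ℂ :=
  Matrix.of fun i j => L i (EuclideanSpace.single j 1)

/-- The endomorphism of `ℂⁿ` with the given functionals as components. -/
noncomputable def functionalMap (L : Fin n → Cn n →L[ℂ] ℂ) : Cn n →L[ℂ] Cn n :=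
  ((EuclideanSpace.equiv (Fin n) ℂ).symm : (Fin n → ℂ) →L[ℂ] Cn n).comp (ContinuousLinearMap.pi L)

theorem functionalMap_apply (L : Fin n → Cn n →L[ℂ] ℂ) (w : Cn n) (i : Fin n) :
    functionalMap L w i = L i w := rfl

theorem det_functionalMap (L : Fin n → Cn n →L[ℂ] ℂ) :
    (functionalMap L).det = (functionalMatrix L).det := by
  rw [ContinuousLinearMap.det, ← LinearMap.det_toMatrix (EuclideanSpace.basisFun (Fin n) ℂ).toBasis]
  congr 1

theorem functionalMatrix_smul (c : Fin n → ℂ) (L : Fin n → Cn n →L[ℂ] ℂ) :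
    (functionalMatrix fun i => c i • L i).det = (∏ i, c i) * (functionalMatrix L).det := by
  rw [← Matrix.det_mul_column]
  rfl

theorem functional_apply_eq_sum (l : Cn n →L[ℂ] ℂ) (w : Cn n) :
    l w = ∑ j, l (EuclideanSpace.single j 1) * w j := by
  conv_lhs => rw [← (EuclideanSpace.basisFun (Fin n) ℂ).sum_repr w]
  simp [mul_comm]

/-- If the coordinate rows did not span, a nonzero linear form vanishing on them would be a nonzero
vector killed by all of `A`. -/
theorem exists_det_ne_zero_of_separating {A : Set (Cn n →L[ℂ] ℂ)}
    (hA : ∀ v : Cn n, v ≠ 0 → ∃ l ∈ A, l v ≠ 0) :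
    ∃ L : Fin n → Cn n →L[ℂ] ℂ, (∀ i, L i ∈ A) ∧ (functionalMatrix L).det ≠ 0 := by
  let row : (Cn n →L[ℂ] ℂ) → Fin n → ℂ := fun l j => l (EuclideanSpace.single j 1)
  have hspan : Submodule.span ℂ (row '' A) = ⊤ := by
    by_contra hne
    obtain ⟨f, hf, hker⟩ := Submodule.exists_le_ker_of_lt_top _ (lt_top_iff_ne_top.2 hne)
    let v : Cn n := WithLp.toLp 2 fun j => f (Pi.single j 1)
    have hfv : ∀ r : Fin n → ℂ, f r = ∑ j, r j * v j := by
      intro r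
      conv_lhs => rw [← Finset.univ_sum_single r]
      rw [map_sum]
      refine Finset.sum_congr rfl fun j _ => ?_
      rw [← mul_one (r j), ← smul_eq_mul (r j) 1, Pi.single_smul, map_smul]
      simp [v]
    have hv : v ≠ 0 := by
      intro h0
      refine hf (LinearMap.ext fun r => ?_)
      rw [hfv, h0]
      simp
    obtain ⟨l, hl, hlv⟩ := hA v hv
    refine hlv ?_
    rw [functional_apply_eq_sum, ← hfv (row l)]
    exact hker (Submodule.subset_span ⟨l, hl, rfl⟩)
  obtain ⟨f, hf, -, hli⟩ := Submodule.exists_fun_fin_finrank_span_eq ℂ (row '' A)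
  have hrank : Module.finrank ℂ (Submodule.span ℂ (row '' A)) = n := by
    rw [hspan, finrank_top, Module.finrank_fin_fun]
  choose L hL hLf using fun i : Fin n => hf (Fin.cast hrank.symm i)
  refine ⟨L, hL, ?_⟩
  have hrow : (functionalMatrix L).row = f ∘ Fin.cast hrank.symm := by
    ext i j
    rw [Function.comp_apply, ← hLf i]
    rfl
  have hli' : LinearIndependent ℂ (functionalMatrix L).row := by
    rw [hrow]
    exact hli.comp _ (Fin.cast_injective _)
  exact ((Matrix.isUnit_iff_isUnit_det _).1
    (Matrix.linearIndependent_rows_iff_isUnit.1 hli')).ne_zero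

/-- Auerbach's lemma: a compact separating set of functionals contains a basis in which all its
members have coordinates of modulus at most one. -/
theorem exists_auerbach {A : Set (Cn n →L[ℂ] ℂ)} (hA : IsCompact A)
    (hsep : ∀ v : Cn n, v ≠ 0 → ∃ l ∈ A, l v ≠ 0) :
    ∃ L : Fin n → Cn n →L[ℂ] ℂ, (∀ i, L i ∈ A) ∧ (functionalMatrix L).det ≠ 0 ∧
      ∀ l ∈ A, ∀ v, ‖l v‖ ≤ ∑ i, ‖L i v‖ := by
  obtain ⟨L₀, hL₀, hdet₀⟩ := exists_det_ne_zero_of_separating hsep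
  have hcont : Continuous fun L : Fin n → Cn n →L[ℂ] ℂ => ‖(functionalMatrix L).det‖ := by
    refine (Continuous.matrix_det ?_).norm
    refine continuous_matrix fun i j => ?_
    change Continuous fun L : Fin n → Cn n →L[ℂ] ℂ => L i (EuclideanSpace.single j 1)
    fun_prop
  obtain ⟨L, hL, hmax⟩ := (isCompact_univ_pi fun _ : Fin n => hA).exists_isMaxOn
    ⟨L₀, fun i _ => hL₀ i⟩ hcont.continuousOn
  have hpos : 0 < ‖(functionalMatrix L).det‖ :=
    (norm_pos_iff.2 hdet₀).trans_le (hmax (show L₀ ∈ _ from fun i _ => hL₀ i))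
  have hdet : (functionalMatrix L).det ≠ 0 := norm_pos_iff.1 hpos
  refine ⟨L, fun i => hL i trivial, hdet, fun l hl v => ?_⟩
  set M := functionalMatrix L with hM
  let b : Fin n → ℂ := fun j => l (EuclideanSpace.single j 1)
  have hunit : IsUnit M.det := isUnit_iff_ne_zero.2 hdet
  -- By Cramer's rule the `i`-th coordinate of `l` is a quotient of determinants, the numerator
  -- having `L i` replaced by `l`; maximality of `L` bounds it by one.
  have hc1 : ∀ i, ‖(b ᵥ* M⁻¹) i‖ ≤ 1 := by
    intro i
    have h1 := congrFun (Matrix.det_smul_inv_vecMul_eq_cramer_transpose M b hunit) i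
    rw [Matrix.cramer_transpose_apply, Pi.smul_apply, smul_eq_mul] at h1
    have h2 : M.updateRow i b = functionalMatrix (Function.update L i l) := by
      ext i' j
      rcases eq_or_ne i' i with rfl | hne
      · simp [functionalMatrix, b]
      · simp [functionalMatrix, hM, hne]
    have h3 : ‖(functionalMatrix (Function.update L i l)).det‖ ≤ ‖M.det‖ := by
      refine hmax (show Function.update L i l ∈ _ from fun i' _ => ?_)
      rcases eq_or_ne i' i with rfl | hne
      · simpa using hl
      · simpa [hne] using hL i' trivial
    rw [← h2, ← h1, norm_mul] at h3
    exact le_of_mul_le_mul_left (by simpa using h3) hpos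
  have hb : (b ᵥ* M⁻¹) ᵥ* M = b := by
    rw [Matrix.vecMul_vecMul, Matrix.nonsing_inv_mul _ hunit, Matrix.vecMul_one]
  have hlv : l v = ∑ i, (b ᵥ* M⁻¹) i * L i v := by
    calc l v = b ⬝ᵥ v.ofLp := functional_apply_eq_sum l v
      _ = ((b ᵥ* M⁻¹) ᵥ* M) ⬝ᵥ v.ofLp := by rw [hb]
      _ = (b ᵥ* M⁻¹) ⬝ᵥ (M *ᵥ v.ofLp) := (Matrix.dotProduct_mulVec _ _ _).symm
      _ = _ := Finset.sum_congr rfl fun i _ => by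
        rw [functional_apply_eq_sum (L i) v]
        rfl
  rw [hlv]
  refine (norm_sum_le _ _).trans (Finset.sum_le_sum fun i _ => ?_)
  rw [norm_mul]
  exact mul_le_of_le_one_left (norm_nonneg _) (hc1 i)

end Functionals

/-! ### Bounds for the two volume elements -/

section Volume

variable {n : ℕ} {D : Set (Cn n)}

theorem exists_norm_det_le (n : ℕ) (r : ℝ) :
    ∃ C : ℝ, 0 < C ∧ ∀ A : Cn n →L[ℂ] Cn n, ‖A‖ ≤ r → ‖A.det‖ ≤ C := by
  have : ProperSpace (Cn n →L[ℂ] Cn n) := FiniteDimensional.proper ℂ _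
  obtain ⟨C, hC⟩ := (isCompact_closedBall (0 : Cn n →L[ℂ] Cn n) r).exists_bound_of_continuousOn
    ContinuousLinearMap.continuous_det.continuousOn
  exact ⟨max C 1, by positivity, fun A hA => (hC A (by simpa using hA)).trans (le_max_left _ _)⟩

/-- The Schwarz estimate on a ball about `z` bounds the derivatives. Without boundedness the real
`sSup` would be the default `0`. -/
theorem bddAbove_caratheodory (hD : IsOpen D) {z : Cn n} (hz : z ∈ D) :
    BddAbove {r : ℝ | ∃ ψ : Cn n → Cn n, IsHolomorphicInto ψ D (unitBall n) ∧ ψ z = 0 ∧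
      r = ‖jacobianDet ψ z‖ ^ 2} := by
  obtain ⟨δ, hδ, hball⟩ := Metric.mem_nhds_iff.1 (hD.mem_nhds hz)
  obtain ⟨C, -, hC⟩ := exists_norm_det_le n (1 / δ)
  refine ⟨C ^ 2, ?_⟩
  rintro _ ⟨ψ, ⟨hψd, hψm⟩, hψz, rfl⟩
  refine pow_le_pow_left₀ (norm_nonneg _) (hC _ ?_) 2
  refine Complex.norm_fderiv_le_div_of_mapsTo_ball (hψd.mono hball) ?_ hδ
  rw [hψz]
  exact fun w hw => Metric.ball_subset_closedBall (hψm (hball hw))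

/-- The Kobayashi–Eisenman volume element is positive as soon as some holomorphic map into the ball
is nondegenerate. -/
theorem kobayashiVolume_pos (hD : IsOpen D) {z : Cn n} (hz : z ∈ D) {ψ : Cn n → Cn n}
    (hψ : IsHolomorphicInto ψ D (unitBall n)) (hψz : ψ z = 0) (hψ0 : jacobianDet ψ z ≠ 0)
    (hne : ∃ φ : Cn n → Cn n, IsHolomorphicInto φ (unitBall n) D ∧ φ 0 = z ∧ jacobianDet φ 0 ≠ 0) :
    0 < kobayashiVolume D z := by
  obtain ⟨C, hC0, hC⟩ := exists_norm_det_le n 1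
  have hψp : 0 < ‖jacobianDet ψ z‖ := norm_pos_iff.2 hψ0
  -- For a competitor `φ`, the map `ψ ∘ φ` sends the ball to itself and fixes `0`, so its
  -- determinant is at most `C` and that of `φ` at most `C / |det ψ'(z)|`. A competitor must exist,
  -- since `sInf ∅ = 0`.
  refine lt_of_lt_of_le (show 0 < (‖jacobianDet ψ z‖ / C) ^ 2 by positivity) (le_csInf ?_ ?_)
  · obtain ⟨φ, h1, h2, h3⟩ := hne
    exact ⟨_, φ, h1, h2, h3, rfl⟩
  · rintro _ ⟨φ, ⟨hφd, hφm⟩, hφ0, hφn, rfl⟩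
    have hφp : 0 < ‖jacobianDet φ 0‖ := norm_pos_iff.2 hφn
    have hd1 : DifferentiableAt ℂ φ 0 :=
      hφd.differentiableAt (Metric.ball_mem_nhds _ one_pos)
    have hd2 : DifferentiableAt ℂ ψ (φ 0) := by
      rw [hφ0]
      exact hψ.1.differentiableAt (hD.mem_nhds hz)
    have hcomp : (fderiv ℂ (ψ ∘ φ) 0).det = jacobianDet ψ z * jacobianDet φ 0 := by
      rw [fderiv_comp 0 hd2 hd1, hφ0]
      exact LinearMap.det_comp _ _
    have hle : ‖(fderiv ℂ (ψ ∘ φ) 0).det‖ ≤ C := by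
      refine hC _ (Complex.norm_fderiv_le_one_of_mapsTo_ball (R := 1) (hψ.1.comp hφd hφm) ?_ one_pos)
      rw [Function.comp_apply, hφ0, hψz]
      exact fun w hw => Metric.ball_subset_closedBall (hψ.2 (hφm hw))
    rw [hcomp, norm_mul] at hle
    rw [← inv_pow]
    refine pow_le_pow_left₀ (by positivity) ?_ 2
    rw [div_le_iff₀ hC0, le_inv_mul_iff₀ hφp]
    linarith

/-- A basis of omitted functionals yields holomorphic maps into the ball with Jacobian controlled
from below. -/
theorem IsCConvex.exists_map_into_ball (hC : IsCConvex D) (hD : IsOpen D) {z : Cn n} (hz : z ∈ D)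
    (hn : 0 < n) {L : Fin n → Cn n →L[ℂ] ℂ} (hL : ∀ i, L i ∈ omittedFunctionals D z)
    (hdet : (functionalMatrix L).det ≠ 0) {c : ℝ} (hc0 : 0 < c) (hc : c < 1 / 4) :
    ∃ ψ : Cn n → Cn n, IsHolomorphicInto ψ D (unitBall n) ∧ ψ z = 0 ∧
      (c ^ 2 / n) ^ n * ‖(functionalMatrix L).det‖ ^ 2 ≤ ‖jacobianDet ψ z‖ ^ 2 := by
  have hLne : ∀ i, L i ≠ 0 := by
    intro i h0
    exact hdet (Matrix.det_eq_zero_of_row_eq_zero i fun j => by simp [functionalMatrix, h0])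
  have hopen : ∀ i, IsOpen ((fun w => L i (w - z)) '' D) := by
    intro i
    have hsurj : Function.Surjective (L i) :=
      LinearMap.surjective_of_ne_zero (f := (L i : Cn n →ₗ[ℂ] ℂ))
        (fun h => hLne i (ContinuousLinearMap.coe_injective h))
    exact (((L i).isOpenMap hsurj).comp (Homeomorph.subRight z).isOpenMap) D hD
  have hex : ∀ i, ∃ f, IsUnivalentIntoDisc ((fun w => L i (w - z)) '' D) f ∧ c ≤ ‖deriv f 0‖ := by
    intro i
    refine (hC.hasContinuousLogs_image hD z (hLne i)).exists_deriv_ge (hopen i)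
      ⟨z, hz, by simp⟩ ?_ hc
    rintro ⟨w, hw, h1⟩
    exact hL i w hw h1
  choose f hf hfc using hex
  have hmem : ∀ i, ∀ w ∈ D, L i (w - z) ∈ (fun w => L i (w - z)) '' D := fun i w hw => ⟨w, hw, rfl⟩
  have hnR : (0 : ℝ) < n := by exact_mod_cast hn
  -- The factor `1 / √n` puts the unit polydisc into the unit ball.
  set κ : ℂ := (((√(n : ℝ))⁻¹ : ℝ) : ℂ) with hκ
  have hκn : ‖κ‖ ^ 2 = (n : ℝ)⁻¹ := by
    rw [hκ, Complex.norm_real, Real.norm_eq_abs, sq_abs, inv_pow, Real.sq_sqrt hnR.le]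
  let ψ : Cn n → Cn n := fun w =>
    (EuclideanSpace.equiv (Fin n) ℂ).symm fun i => κ * f i (L i (w - z))
  have hder : ∀ w ∈ D, HasFDerivAt ψ
      (functionalMap fun i => (κ * deriv (f i) (L i (w - z))) • L i) w := by
    intro w hw
    refine ((EuclideanSpace.equiv (Fin n) ℂ).symm : (Fin n → ℂ) →L[ℂ] Cn n).hasFDerivAt.comp w ?_
    rw [hasFDerivAt_pi]
    intro i
    have h1 : HasDerivAt (f i) (deriv (f i) (L i (w - z))) (L i (w - z)) :=
      ((hf i).differentiableOn.differentiableAt ((hopen i).mem_nhds (hmem i w hw))).hasDerivAt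
    have h2 : HasFDerivAt (fun w => L i (w - z)) (L i) w :=
      (L i).hasFDerivAt.comp w ((hasFDerivAt_id w).sub_const z)
    have h3 := (h1.comp_hasFDerivAt w h2).const_mul κ
    rwa [smul_smul] at h3
  refine ⟨ψ, ⟨fun w hw => (hder w hw).differentiableAt.differentiableWithinAt, fun w hw => ?_⟩,
    ?_, ?_⟩
  · rw [unitBall, mem_ball_zero_iff]
    refine lt_of_pow_lt_pow_left₀ 2 zero_le_one ?_
    rw [EuclideanSpace.norm_sq_eq]
    have hlt : ∀ i, ‖ψ w i‖ ^ 2 < (n : ℝ)⁻¹ := by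
      intro i
      change ‖κ * f i (L i (w - z))‖ ^ 2 < _
      rw [norm_mul, mul_pow, hκn]
      exact mul_lt_of_lt_one_right (by positivity)
        (pow_lt_one₀ (norm_nonneg _) ((hf i).norm_lt_one _ (hmem i w hw)) two_ne_zero)
    have : Nonempty (Fin n) := ⟨⟨0, hn⟩⟩
    calc ∑ i, ‖ψ w i‖ ^ 2 < ∑ _i : Fin n, (n : ℝ)⁻¹ :=
          Finset.sum_lt_sum_of_nonempty Finset.univ_nonempty fun i _ => hlt i
      _ = 1 ^ 2 := by simp [hnR.ne']
  · have : (fun i => κ * f i (L i (z - z))) = 0 := by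
      ext i
      simp [(hf i).map_zero]
    simp only [ψ, this, map_zero]
  · rw [jacobianDet, (hder z hz).fderiv, det_functionalMap, functionalMatrix_smul, norm_mul,
      mul_pow]
    refine mul_le_mul_of_nonneg_right ?_ (by positivity)
    rw [norm_prod, ← Finset.prod_pow]
    calc (c ^ 2 / n) ^ n = ∏ _i : Fin n, (c ^ 2 / n) := by simp [div_pow]
      _ ≤ _ := Finset.prod_le_prod (fun _ _ => by positivity) fun i _ => by
        rw [sub_self, map_zero, norm_mul, mul_pow, hκn, div_eq_inv_mul]
        gcongr
        exact hfc i

/-- An Auerbach basis of omitted functionals yields an affine map of the ball into `D`. -/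
theorem IsCConvex.exists_map_from_ball (hC : IsCConvex D) (hD : IsOpen D) {z : Cn n} (hz : z ∈ D)
    (hn : 0 < n) {L : Fin n → Cn n →L[ℂ] ℂ} (hdet : (functionalMatrix L).det ≠ 0)
    (hL : ∀ l ∈ omittedFunctionals D z, ∀ v, ‖l v‖ ≤ ∑ i, ‖L i v‖) :
    ∃ φ : Cn n → Cn n, IsHolomorphicInto φ (unitBall n) D ∧ φ 0 = z ∧ jacobianDet φ 0 ≠ 0 ∧
      (‖jacobianDet φ 0‖ ^ 2)⁻¹ = (n : ℝ) ^ n * ‖(functionalMatrix L).det‖ ^ 2 := by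
  have hnR : (0 : ℝ) < n := by exact_mod_cast hn
  have hs : 0 < √(n : ℝ) := Real.sqrt_pos.2 hnR
  set κ : ℂ := ((√(n : ℝ) : ℝ) : ℂ) with hκ
  have hκ0 : κ ≠ 0 := Complex.ofReal_ne_zero.2 hs.ne'
  have hκn : ‖κ‖ = √(n : ℝ) := by rw [hκ, Complex.norm_real, Real.norm_eq_abs, abs_of_pos hs]
  let P := functionalMap fun i => κ • L i
  have hP : P.det = κ ^ n * (functionalMatrix L).det := by
    rw [det_functionalMap, functionalMatrix_smul (fun _ => κ)]
    simp
  have hP0 : P.det ≠ 0 := by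
    rw [hP]
    exact mul_ne_zero (pow_ne_zero _ hκ0) hdet
  let T : Cn n ≃L[ℂ] Cn n := (P.toContinuousLinearEquivOfDetNeZero hP0).symm
  have hTdet : (T : Cn n →L[ℂ] Cn n).det = P.det⁻¹ := by
    rw [ContinuousLinearEquiv.det_coe_symm,
      ContinuousLinearMap.coe_toContinuousLinearEquivOfDetNeZero]
  have hPT : ∀ w, P (T w) = w := fun w =>
    (P.toContinuousLinearEquivOfDetNeZero hP0).apply_symm_apply w
  have hTL : ∀ l ∈ omittedFunctionals D z, ∀ w, ‖l (T w)‖ ≤ ‖w‖ := by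
    intro l hl w
    have h1 : ∀ i, ‖w i‖ = √(n : ℝ) * ‖L i (T w)‖ := by
      intro i
      conv_lhs => rw [← hPT w]
      rw [functionalMap_apply, smul_apply, norm_smul, hκn]
    have h2 : √(n : ℝ) * ∑ i, ‖L i (T w)‖ = ∑ i, ‖w i‖ := by
      rw [Finset.mul_sum]
      exact Finset.sum_congr rfl fun i _ => (h1 i).symm
    -- Cauchy–Schwarz; the loss `√n` is what the scaling of the functionals in `P` compensates.
    have h3 : ∑ i, ‖w i‖ ≤ √(n : ℝ) * ‖w‖ := by
      refine le_of_pow_le_pow_left₀ two_ne_zero (by positivity) ?_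
      rw [mul_pow, Real.sq_sqrt hnR.le, EuclideanSpace.norm_sq_eq]
      simpa using sq_sum_le_card_mul_sum_sq (s := Finset.univ) (f := fun i => ‖w i‖)
    rw [← h2] at h3
    exact (hL l hl _).trans (le_of_mul_le_mul_left h3 hs)
  have hjac : jacobianDet (fun w => z + T w) 0 = P.det⁻¹ := by
    rw [jacobianDet, fderiv_const_add, T.fderiv, hTdet]
  refine ⟨fun w => z + T w, ⟨by fun_prop, fun w hw => ?_⟩, by simp, ?_, ?_⟩
  · exact hC.ellipsoid_subset hD hz T hTL (by simpa [unitBall] using hw)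
  · rw [hjac]
    exact inv_ne_zero hP0
  · rw [hjac, norm_inv, inv_pow, inv_inv, hP, norm_mul, norm_pow, hκn, mul_pow, ← pow_mul,
      mul_comm n 2, pow_mul, Real.sq_sqrt hnR.le]

end Volume

/-! ### The estimate of the quotient invariant -/

theorem corollaryq (n : ℕ) (hn : 2 ≤ n) (D : Set (Cn n)) (hD : IsDomainCn D)
    (hconv : IsCConvex D) (hnd : IsNondegenerate D) (z : Cn n) (hz : z ∈ D) :
    0 < kobayashiVolume D z ∧
      ((3 : ℝ) / (16 * (n : ℝ) * ((4 : ℝ) ^ n - 1))) ^ n ≤ quotientInvariant D z := by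
  have hn0 : 0 < n := by omega
  have hnR : (0 : ℝ) < n := by exact_mod_cast hn0
  obtain ⟨L, hLmem, hdet, hL⟩ := exists_auerbach (isCompact_omittedFunctionals hD.1 hz)
    (fun v hv => hconv.exists_omittedFunctional_ne_zero hD.1 hnd hz hv)
  set d : ℝ := ‖(functionalMatrix L).det‖ with hd
  have hd0 : 0 < d := norm_pos_iff.2 hdet
  obtain ⟨φ, hφ, hφ0, hφn, hφd⟩ := hconv.exists_map_from_ball hD.1 hz hn0 hdet hL
  have hkpos : 0 < kobayashiVolume D z := by
    -- Any constant in `(0, 1 / 4)` would do here: only a nonzero Jacobian is needed.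
    obtain ⟨ψ, hψ, hψz, hψd⟩ := hconv.exists_map_into_ball hD.1 hz hn0 hLmem hdet (c := 1 / 8)
      (by norm_num) (by norm_num)
    refine kobayashiVolume_pos hD.1 hz hψ hψz (fun h0 => ?_) ⟨φ, hφ, hφ0, hφn⟩
    rw [h0, norm_zero, zero_pow two_ne_zero] at hψd
    exact absurd hψd (not_le.2 (by positivity))
  have hkle : kobayashiVolume D z ≤ (n : ℝ) ^ n * d ^ 2 := by
    rw [← hφd]
    refine csInf_le ⟨0, ?_⟩ ⟨φ, hφ, hφ0, hφn, rfl⟩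
    rintro _ ⟨_, -, -, -, rfl⟩
    positivity
  have hcle : ((1 / 4 : ℝ) ^ 2 / n) ^ n * d ^ 2 ≤ caratheodoryVolume D z := by
    -- The univalent maps are available only for `c < 1 / 4`; the bound with `1 / 4` itself is the
    -- limit.
    have htend : Tendsto (fun c : ℝ => (c ^ 2 / n) ^ n * d ^ 2) (𝓝[<] (1 / 4))
        (𝓝 (((1 / 4 : ℝ) ^ 2 / n) ^ n * d ^ 2)) :=
      (by fun_prop : Continuous fun c : ℝ => (c ^ 2 / n) ^ n * d ^ 2).continuousAt.tendsto.mono_left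
        nhdsWithin_le_nhds
    refine le_of_tendsto htend ?_
    filter_upwards [self_mem_nhdsWithin,
      nhdsWithin_le_nhds (lt_mem_nhds (by norm_num : (0 : ℝ) < 1 / 4))] with c hc hc0
    obtain ⟨ψ, hψ, hψz, hψd⟩ := hconv.exists_map_into_ball hD.1 hz hn0 hLmem hdet hc0 hc
    exact hψd.trans (le_csSup (bddAbove_caratheodory hD.1 hz) ⟨ψ, hψ, hψz, rfl⟩)
  refine ⟨hkpos, ?_⟩
  rw [quotientInvariant, le_div_iff₀ hkpos]
  -- Bernoulli's inequality, by which `3 / (4 ^ n - 1) ≤ 1 / n`: the stated constant is at most the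
  -- `1 / (16 n ^ 2)` obtained here.
  have h4 : 1 + (n : ℝ) * 3 ≤ 4 ^ n := by
    have := one_add_mul_le_pow (show (-2 : ℝ) ≤ 3 by norm_num) n
    norm_num at this
    exact this
  have hbase : (3 : ℝ) / (16 * n * (4 ^ n - 1)) * n ≤ (1 / 4) ^ 2 / n := by
    have hpos : (0 : ℝ) < 4 ^ n - 1 := by linarith
    rw [div_mul_eq_mul_div, div_le_div_iff₀ (by positivity) hnR]
    nlinarith
  have hnn : (0 : ℝ) ≤ 3 / (16 * n * (4 ^ n - 1)) := by
    have hpos : (0 : ℝ) < 4 ^ n - 1 := by linarith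
    positivity
  calc ((3 : ℝ) / (16 * n * (4 ^ n - 1))) ^ n * kobayashiVolume D z
      ≤ ((3 : ℝ) / (16 * n * (4 ^ n - 1))) ^ n * ((n : ℝ) ^ n * d ^ 2) := by gcongr
    _ = ((3 : ℝ) / (16 * n * (4 ^ n - 1)) * n) ^ n * d ^ 2 := by rw [mul_pow]; ring
    _ ≤ ((1 / 4) ^ 2 / n) ^ n * d ^ 2 := by gcongr
    _ ≤ _ := hcle
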